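/- Let $N\ge 1$. Consider the $2^N$-dimensional Hilbert space with orthonormal ("incoherent") basis $|\mathbf n\rangle$, $\mathbf n\in\{0,1\}^N$, and put $|\mathbf n|=\sum_l n_l$. For $\lambda\in[0,1]$ let $C[\lambda]$ be the matrix with entries $c_{\mathbf n\mathbf m}=\lambda^{(|\mathbf n|-|\mathbf m|)^2}$ (with $0^0=1$). For a matrix $C$ let $\mathcal C_C$ be the set of incoherent (diagonal) POVMs that are jointly measurable with the entrywise product $C*\mathsf Q=(C*\mathsf Q(i))_i$ for every POVM $\mathsf Q$ with finitely many outcomes. For $j=0,\dots,N$ let $\mathsf P(j)$ be the projection onto $\mathrm{span}\{|\mathbf n\rangle : |\mathbf n|=j\}$, and for $\alpha\in[0,1]$ let $\mathsf P_\alpha(j)=\alpha\,\mathsf P(j)+(1-\alpha)2^{-N}\mathrm{tr}[\mathsf P(j)]\,\mathbb 1$. Define $$\alpha_N(\lambda)=\max\{\alpha\in[0,1] : \mathsf P_\alpha\in\mathcal C_{C[\lambda]}\}.$$ With $c_k=\binom Nk 2^{-N}$ and $u_k(\alpha)=\sqrt{c_k(1-\alpha)\,(\alpha+c_k(1-\alpha))}$,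 let $$\beta_{01}(\alpha)=u_0(\alpha)+u_1(\alpha)+(1-\alpha)(1-c_0-c_1),$$ let $U_N=\beta_{01}^{-1}$, and let $k_N=2^{-N/2}(1+\sqrt N)$. Then: 1. The maximum defining $\alpha_N(\lambda)$ exists for every $\lambda\in[0,1]$, and $\alpha_N$ and $\beta_{01}$ are strictly decreasing bijections of $[0,1]$ onto itself, so that the inverses $\alpha_N^{-1}$ and $U_N=\beta_{01}^{-1}$ are well defined bijections of $[0,1]$. 2. The curves $\alpha=\alpha_N(\lambda)$ and $\alpha=U_N(\lambda)$ have the same asymptotic form $$\lambda=k_N\sqrt{1-\alpha}+O(1-\alpha)\qquad(\alpha\to1),$$ that is, both $\alpha_N^{-1}(\alpha)$ and $U_N^{-1}(\alpha)$ equal $k_N\sqrt{1-\alpha}+O(1-\alpha)$ as $\alpha\to 1$ from below. 3. For every $\alpha\in(0,1]$, $$\bigl|\alpha_N^{-1}(\alpha)-k_N\sqrt{1-\alpha}\bigr|\le 1-\alpha+\tfrac32 k_N\Bigl(\tfrac{1-\alpha}{\alpha}\Bigr)^{3/2}.$$ 4. If $N\ne2$, then for every $\alpha\in[0,1]$ one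 has $u_0(\alpha)+u_1(\alpha)\le\alpha_N^{-1}(\alpha)$, and for $\lambda=u_0(\alpha)+u_1(\alpha)$ there is a genuinely incoherent instrument with coherence matrix $C[\lambda]$ that measures $\mathsf P_\alpha$: that is, completely positive maps $\mathsf I_0,\dots,\mathsf I_N$ whose sum $\Lambda$ is trace preserving, fixes every $|\mathbf n\rangle\langle\mathbf n|$ and has dual $\Lambda^*(X)=C[\lambda]*X$, and with $\mathrm{tr}[\mathsf I_j(\rho)]=\mathrm{tr}[\mathsf P_\alpha(j)\rho]$ for all $j$ and $\rho$. -/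

import Mathlib

open scoped ComplexOrder Matrix Topology

namespace CoherenceIncompat

/-- A POVM (observable) with finite outcome set `Ω`: positive semidefinite matrices
summing to the identity. The incoherent basis is the standard basis indexed by `ι`. -/
def IsPOVM {ι Ω : Type*} [Fintype ι] [DecidableEq ι] [Fintype Ω]
    (M : Ω → Matrix ι ι ℂ) : Prop :=
  (∀ i, (M i).PosSemidef) ∧ ∑ i, M i = 1

/-- An observable is incoherent if all its matrices are diagonal. -/
def IsIncoherent {ι Ω : Type*} (P : Ω → Matrix ι ι ℂ) : Prop :=
  ∀ i, (P i).IsDiag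

/-- Joint measurability: existence of a joint observable with the given marginals. -/
def JointlyMeasurable {ι Ω₁ Ω₂ : Type*} [Fintype ι] [DecidableEq ι] [Fintype Ω₁] [Fintype Ω₂]
    (M : Ω₁ → Matrix ι ι ℂ) (F : Ω₂ → Matrix ι ι ℂ) : Prop :=
  ∃ G : Ω₁ × Ω₂ → Matrix ι ι ℂ, IsPOVM G ∧
    (∀ i, ∑ j, G (i, j) = M i) ∧ (∀ j, ∑ i, G (i, j) = F j)

/-- The set of incoherent observables (with outcome set `Ω`) that are jointly measurable with
the Hadamard product `C * Q` for every observable `Q` with finitely many outcomes. -/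
def compatSet {ι : Type*} [Fintype ι] [DecidableEq ι] (Ω : Type*) [Fintype Ω]
    (C : Matrix ι ι ℂ) : Set (Ω → Matrix ι ι ℂ) :=
  {P | IsPOVM P ∧ IsIncoherent P ∧
    ∀ (r : ℕ) (Q : Fin r → Matrix ι ι ℂ), IsPOVM Q →
      JointlyMeasurable (fun i => C ⊙ Q i) P}

/-! Genuinely incoherent instruments -/

/-- Complete positivity of a linear map `Φ` on matrices: every ampliation `id_k ⊗ Φ` preserves
positive semidefiniteness. -/
def IsCompletelyPositive {ι : Type*} (Φ : Matrix ι ι ℂ →ₗ[ℂ] Matrix ι ι ℂ) : Prop :=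
  ∀ (k : ℕ) (X : Matrix (Fin k × ι) (Fin k × ι) ℂ), X.PosSemidef →
    (Matrix.of fun p q : Fin k × ι =>
      Φ (Matrix.of fun a b : ι => X (p.1, a) (q.1, b)) p.2 q.2).PosSemidef

/-- An instrument (in the Schrödinger picture): completely positive maps whose sum is trace
preserving. -/
def IsInstrument {ι Ω : Type*} [Fintype ι] [Fintype Ω]
    (I : Ω → (Matrix ι ι ℂ →ₗ[ℂ] Matrix ι ι ℂ)) : Prop :=
  (∀ j, IsCompletelyPositive (I j)) ∧
    ∀ ρ : Matrix ι ι ℂ, Matrix.trace (∑ j, I j ρ) = Matrix.trace ρ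

/-- A genuinely incoherent instrument: its channel fixes every `|n⟩⟨n|`. -/
def IsGII {ι Ω : Type*} [Fintype ι] [DecidableEq ι] [Fintype Ω]
    (I : Ω → (Matrix ι ι ℂ →ₗ[ℂ] Matrix ι ι ℂ)) : Prop :=
  IsInstrument I ∧ ∀ n : ι, ∑ j, I j (Matrix.single n n 1) = Matrix.single n n 1

/-- `C` is the coherence matrix of `I`: the dual (Heisenberg) channel is `X ↦ C * X`
(Hadamard product). -/
def HasCoherenceMatrix {ι Ω : Type*} [Fintype ι] [Fintype Ω]
    (I : Ω → (Matrix ι ι ℂ →ₗ[ℂ] Matrix ι ι ℂ)) (C : Matrix ι ι ℂ) : Prop :=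
  ∀ X ρ : Matrix ι ι ℂ, Matrix.trace ((C ⊙ X) * ρ) = Matrix.trace (X * ∑ j, I j ρ)

/-- `P` is the observable measured by `I`: outcome probabilities are `tr (P j ρ)`. -/
def Measures {ι Ω : Type*} [Fintype ι]
    (I : Ω → (Matrix ι ι ℂ →ₗ[ℂ] Matrix ι ι ℂ)) (P : Ω → Matrix ι ι ℂ) : Prop :=
  ∀ j, ∀ ρ : Matrix ι ι ℂ, Matrix.trace (I j ρ) = Matrix.trace (P j * ρ)

/-! The spin-boson model of `N` qubits -/

/-- Number of ones in a bit string. -/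
def ones {N : ℕ} (n : Fin N → Fin 2) : ℕ := ∑ l, (n l : ℕ)

/-- The coherence matrix `c_{n,m} = lam ^ ((|n| - |m|)^2)` (with `0 ^ 0 = 1`). -/
noncomputable def spinBoson (N : ℕ) (lam : ℝ) : Matrix (Fin N → Fin 2) (Fin N → Fin 2) ℂ :=
  Matrix.of fun n m => ((lam ^ (((ones n : ℤ) - (ones m : ℤ)).natAbs ^ 2) : ℝ) : ℂ)

/-- The projection onto the span of the basis vectors with exactly `j` ones; the spectral
resolution of the system Hamiltonian. -/
def dfsProj (N : ℕ) (j : Fin (N + 1)) : Matrix (Fin N → Fin 2) (Fin N → Fin 2) ℂ :=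
  Matrix.diagonal fun n => if ones n = (j : ℕ) then 1 else 0

/-- The depolarisation of `dfsProj`. -/
noncomputable def dfsDep (N : ℕ) (j : Fin (N + 1)) :
    Matrix (Fin N → Fin 2) (Fin N → Fin 2) ℂ :=
  (((2 : ℂ) ^ N)⁻¹ * Matrix.trace (dfsProj N j)) • (1 : Matrix (Fin N → Fin 2) (Fin N → Fin 2) ℂ)

/-- The `α`-weighted average of `dfsProj` and its depolarisation. -/
noncomputable def dfsMix (N : ℕ) (α : ℝ) (j : Fin (N + 1)) :
    Matrix (Fin N → Fin 2) (Fin N → Fin 2) ℂ :=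
  (α : ℂ) • dfsProj N j + ((1 - α : ℝ) : ℂ) • dfsDep N j

/-- The weights `α ∈ [0, 1]` for which the mixed observable has no incompatibility due to the
spin-boson coherence pattern. -/
def compatWeights (N : ℕ) (lam : ℝ) : Set ℝ :=
  {α | α ∈ Set.Icc (0 : ℝ) 1 ∧ dfsMix N α ∈ compatSet (Fin (N + 1)) (spinBoson N lam)}

/-- The critical weight `α_N(lam)`, the largest element of `compatWeights N lam`. -/
noncomputable def alphaN (N : ℕ) (lam : ℝ) : ℝ := sSup (compatWeights N lam)

/-- The binomial ("coin toss") probabilities. -/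
noncomputable def coin (N k : ℕ) : ℝ := (N.choose k : ℝ) / 2 ^ N

/-- `β_{k,k'}(α)`, which for `k ≠ k'` is one minus the squared Hellinger distance between the
distributions of the mixed observable at `k` and `k'`. -/
noncomputable def beta (N k k' : ℕ) (α : ℝ) : ℝ :=
  1 - α
    + (√(coin N k * (1 - α) * (α + coin N k * (1 - α))) - coin N k * (1 - α))
    + (√(coin N k' * (1 - α) * (α + coin N k' * (1 - α))) - coin N k' * (1 - α))

/-- The inverse of a bijection of `[0, 1]` onto itself. -/
noncomputable def unitInv (f : ℝ → ℝ) : ℝ → ℝ := Function.invFunOn f (Set.Icc 0 1)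

/-- The upper bound `U_N`, the inverse function of `β_{01}`. -/
noncomputable def upperN (N : ℕ) : ℝ → ℝ := unitInv (beta N 0 1)

/-- `k_N = (1 + √N) 2^{-N/2}`. -/
noncomputable def kN (N : ℕ) : ℝ := (1 + √(N : ℝ)) / (2 : ℝ) ^ ((N : ℝ) / 2)

/-- `√(q (α + q))` with `q = c_N(k) (1 - α)`. -/
noncomputable def uN (N k : ℕ) (α : ℝ) : ℝ :=
  √(coin N k * (1 - α) * (α + coin N k * (1 - α)))

end CoherenceIncompat

/-! Compatibility is first turned into a statement about matrices (`mem_compatSet_iff`): an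
incoherent POVM is compatible with every `C * Q` exactly when `C` is a sum of positive semidefinite
`D j` with the diagonals of `P j`. One direction tests against the uniform POVM of sign vectors, the
other is the Schur product theorem. The spin-boson matrix depends only on the numbers of ones, so
everything descends to real matrices on the levels `0, …, N` (`Splits`, `mem_compatWeights_iff`).
The same splitting supplies the instrument, whose parts act as `ρ ↦ D j * ρ`.

The set of pairs `(α, lam)` admitting a splitting is compact and closed downwards in each variable.
Positive definiteness of `gauss N lam` for `lam < 1` leaves room to trade one variable strictly for
the other, so the boundary is the graph of a strictly decreasing bijection `alphaN`, and bounding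
its inverse means finding the largest `lam` for a given `α`.

Upper bound (`Splits.le_beta`): the `2 × 2` minors at levels `0, 1` bound `lam` by the Hellinger
affinity `beta N 0 1 α` of the outcome distributions there. Lower bound: explicit splittings reach
`lam = u₀ + u₁` for `N ≠ 2` (`splits_uN_add_uN`), and nearly this value for `N = 2`
(`splits_two_levels`). For `N ≥ 4` the outer outcomes `0, 1, N - 1, N` get rank-one blocks that
produce the extreme neighbouring entries exactly; the inner outcomes, which have larger binomial
weights, absorb all other entries as star-shaped perturbations of diagonal matrices.

Both bounds are `kN N * √(1 - α)` up to `O(1 - α)`, because `beta` exceeds `u₀ + u₁` by at most `1 -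
α` and each `u k` lies between `√(c k (1 - α) α)` and `√(c k (1 - α))`. -/

namespace CoherenceIncompat
open Finset

/-! ### Joint measurability with a Hadamard channel -/

section Compat

variable {ι Ω : Type*} [Fintype ι] [Fintype Ω]

/-- The sign `±1` attached to a Boolean. -/
def signOf (b : Bool) : ℂ := if b then 1 else -1

lemma signOf_mul_self (b : Bool) : signOf b * signOf b = 1 := by
  cases b <;> simp [signOf]

lemma star_signOf (b : Bool) : star (signOf b) = signOf b := by
  cases b <;> simp [signOf]

lemma signOf_not (b : Bool) : signOf (!b) = -signOf b := by
  cases b <;> simp [signOf]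

lemma sum_signOf_mul [DecidableEq ι] (n m : ι) :
    ∑ s : ι → Bool, signOf (s n) * signOf (s m) = if n = m then (2 : ℂ) ^ Fintype.card ι else 0 := by
  split_ifs with h
  · subst h
    simp [signOf_mul_self]
  -- Flipping the sign at `n` alone negates the summand, since `m ≠ n`.
  · refine Finset.sum_involution (fun s _ => Function.update s n (!(s n))) ?_ ?_ ?_ ?_
    · intro s _
      simp [Function.update_of_ne (Ne.symm h), signOf_not]
    · intro s _ _ hs
      have := congrFun hs n
      simp at this
    · intro s _
      exact Finset.mem_univ _
    · intro s _
      simp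

/-- The rank-one effects attached to sign vectors. -/
noncomputable def signEffect (s : ι → Bool) : Matrix ι ι ℂ :=
  ((2 : ℂ) ^ Fintype.card ι)⁻¹ • Matrix.vecMulVec (fun n => signOf (s n))
    (star fun n => signOf (s n))

lemma signEffect_apply (s : ι → Bool) (n m : ι) :
    signEffect s n m = ((2 : ℂ) ^ Fintype.card ι)⁻¹ * (signOf (s n) * signOf (s m)) := by
  simp [signEffect, Matrix.vecMulVec_apply, -RCLike.star_def, star_signOf]

lemma isPOVM_signEffect [DecidableEq ι] : IsPOVM (signEffect : (ι → Bool) → Matrix ι ι ℂ) := by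
  refine ⟨fun s => (Matrix.posSemidef_vecMulVec_self_star _).smul ?_, ?_⟩
  · have : (0 : ℂ) ≤ ((2 : ℝ) ^ Fintype.card ι)⁻¹ := by
      exact_mod_cast (by positivity : (0 : ℝ) ≤ ((2 : ℝ) ^ Fintype.card ι)⁻¹)
    simpa only [Complex.ofReal_inv, Complex.ofReal_pow, Complex.ofReal_ofNat] using this
  · ext n m
    simp_rw [Matrix.sum_apply, signEffect_apply, ← Finset.mul_sum, sum_signOf_mul,
      Matrix.one_apply]
    split_ifs <;> simp

lemma IsPOVM.comp_equiv [DecidableEq ι] {Ω' : Type*} [Fintype Ω'] {M : Ω → Matrix ι ι ℂ} (h : IsPOVM M)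
    (e : Ω' ≃ Ω) : IsPOVM (fun i => M (e i)) :=
  ⟨fun i => h.1 _, by rw [e.sum_comp (fun i => M i)]; exact h.2⟩

/-- An incoherent observable is compatible with all `C * Q` exactly when `C` splits into positive
semidefinite parts with the prescribed diagonals. -/
theorem mem_compatSet_iff [DecidableEq ι] {C : Matrix ι ι ℂ} {P : Ω → Matrix ι ι ℂ} :
    P ∈ compatSet Ω C ↔ IsPOVM P ∧ IsIncoherent P ∧
      ∃ D : Ω → Matrix ι ι ℂ, (∀ j, (D j).PosSemidef) ∧ ∑ j, D j = C ∧
        ∀ j n, D j n n = P j n n := by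
  refine ⟨fun ⟨hP, hI, h⟩ => ⟨hP, hI, ?_⟩, fun ⟨hP, hI, D, hD, hDC, hDP⟩ => ⟨hP, hI, ?_⟩⟩
  · let e := Fintype.equivFin (ι → Bool)
    obtain ⟨G, hG, hG1, hG2⟩ := h (Fintype.card (ι → Bool)) (fun i => signEffect (e.symm i))
      (isPOVM_signEffect.comp_equiv e.symm)
    let S : Fin (Fintype.card (ι → Bool)) → Matrix ι ι ℂ :=
      fun i => Matrix.vecMulVec (fun n => signOf (e.symm i n)) (star fun n => signOf (e.symm i n))
    have hS : ∀ i n m, S i n m = signOf (e.symm i n) * signOf (e.symm i m) := fun i n m => by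
      simp [S, Matrix.vecMulVec_apply, -RCLike.star_def, star_signOf]
    -- Multiplying by the signs a second time undoes them: `S i ⊙ S i` is the all-ones matrix, so
    -- the total is `C`. The diagonal of `S i` is `1`, so diagonals reduce to the second marginal `P
    -- j`.
    refine ⟨fun j => ∑ i, S i ⊙ G (i, j), fun j => ?_, ?_, fun j n => ?_⟩
    · exact Matrix.posSemidef_sum _ fun i _ =>
        (Matrix.posSemidef_vecMulVec_self_star _).hadamard (hG.1 _)
    · rw [Finset.sum_comm]
      ext n m
      have hGi : ∀ i, ∑ j, G (i, j) n m = C n m * signEffect (e.symm i) n m := fun i => by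
        have := congrFun (congrFun (hG1 i) n) m
        simpa [Matrix.sum_apply] using this
      simp_rw [Matrix.sum_apply, Matrix.hadamard_apply, ← Finset.mul_sum, hGi, hS, signEffect_apply]
      have : ∀ i, signOf (e.symm i n) * signOf (e.symm i m) *
          (C n m * (((2 : ℂ) ^ Fintype.card ι)⁻¹ *
            (signOf (e.symm i n) * signOf (e.symm i m)))) =
          C n m * ((2 : ℂ) ^ Fintype.card ι)⁻¹ := fun i => by
        linear_combination (C n m * ((2 : ℂ) ^ Fintype.card ι)⁻¹) *
          (signOf_mul_self (e.symm i n) * signOf (e.symm i m) * signOf (e.symm i m) +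
            signOf_mul_self (e.symm i m))
      simp_rw [this]
      simp
      field_simp
    · have := congrFun (congrFun (hG2 j) n) n
      simp only [Matrix.sum_apply, Matrix.hadamard_apply, hS, signOf_mul_self, one_mul] at this ⊢
      exact this
  · intro r Q hQ
    have hone : ∀ A : Matrix ι ι ℂ, (1 : Matrix ι ι ℂ) ⊙ A = Matrix.diagonal fun n => A n n := by
      intro A
      ext n m
      by_cases h : n = m
      · subst h; simp
      · simp [h]
    have hsumQ : ∀ A : Matrix ι ι ℂ, ∑ i, Q i ⊙ A = Matrix.diagonal fun n => A n n := by
      intro A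
      rw [← hone, ← hQ.2]
      ext n m
      simp [Matrix.sum_apply, Finset.sum_mul]
    have hsumD : ∀ A : Matrix ι ι ℂ, ∑ j, A ⊙ D j = A ⊙ C := by
      intro A
      rw [← hDC]
      ext n m
      simp [Matrix.sum_apply, Finset.mul_sum]
    have hPdiag : ∀ j, (Matrix.diagonal fun n => D j n n) = P j := by
      intro j
      simp_rw [hDP j]
      exact (hI j).diagonal_diag
    -- Summing over `i` replaces `Q` by the identity and leaves the diagonal of `D j`, which is `P
    -- j`; summing over `j` replaces `D` by `C`.
    refine ⟨fun ij => Q ij.1 ⊙ D ij.2, ⟨fun ij => (hQ.1 _).hadamard (hD _), ?_⟩, fun i => ?_,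
      fun j => ?_⟩
    · rw [Fintype.sum_prod_type_right]
      simp_rw [hsumQ, hPdiag]
      exact hP.2
    · simp_rw [hsumD]
      ext n m
      simp [mul_comm]
    · simp_rw [hsumQ, hPdiag]

end Compat

/-! ### Reduction to `N + 1` levels -/

/-- The coherence matrix of the spin-boson model on the levels `0, …, N`. -/
def gauss (N : ℕ) (lam : ℝ) : Matrix (Fin (N + 1)) (Fin (N + 1)) ℝ :=
  Matrix.of fun k l => lam ^ (((k : ℤ) - (l : ℤ)).natAbs ^ 2)

/-- The probability of outcome `j` of the mixed observable on level `k`. -/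
noncomputable def mixProb (N : ℕ) (α : ℝ) (j k : Fin (N + 1)) : ℝ :=
  (if k = j then α else 0) + (1 - α) * coin N j

/-- `gauss N lam` splits into positive semidefinite parts with diagonals `mixProb N α j`. -/
def Splits (N : ℕ) (α lam : ℝ) : Prop :=
  ∃ C : Fin (N + 1) → Matrix (Fin (N + 1)) (Fin (N + 1)) ℝ,
    (∀ j, (C j).PosSemidef) ∧ ∑ j, C j = gauss N lam ∧ ∀ j k, C j k k = mixProb N α j k

lemma ones_le {N : ℕ} (n : Fin N → Fin 2) : ones n ≤ N := by
  calc ones n ≤ ∑ _l : Fin N, 1 := Finset.sum_le_sum fun l _ => by omega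
    _ = N := by simp

/-- The level of a bit string. -/
def level {N : ℕ} (n : Fin N → Fin 2) : Fin (N + 1) := ⟨ones n, Nat.lt_succ_of_le (ones_le n)⟩

/-- The set of ones of a bit string. -/
def bitsEquiv (N : ℕ) : (Fin N → Fin 2) ≃ Finset (Fin N) where
  toFun n := Finset.univ.filter fun l => n l = 1
  invFun s l := if l ∈ s then 1 else 0
  left_inv n := by
    ext l
    have : n l = 0 ∨ n l = 1 := by omega
    rcases this with h | h <;> simp [h]
  right_inv s := by ext; simp

lemma ones_eq_card {N : ℕ} (n : Fin N → Fin 2) : ones n = (bitsEquiv N n).card := by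
  rw [ones, bitsEquiv, Equiv.coe_fn_mk, Finset.card_filter]
  refine Finset.sum_congr rfl fun l _ => ?_
  have : n l = 0 ∨ n l = 1 := by omega
  rcases this with h | h <;> simp [h]

lemma card_ones_eq (N j : ℕ) :
    (Finset.univ.filter fun n : Fin N → Fin 2 => ones n = j).card = N.choose j := by
  have : (Finset.powersetCard j (Finset.univ : Finset (Fin N))).card = N.choose j := by simp
  rw [← this]
  refine Finset.card_equiv (bitsEquiv N) fun n => ?_
  simp [Finset.mem_powersetCard, ones_eq_card]

lemma level_surjective (N : ℕ) : Function.Surjective (level (N := N)) := by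
  intro k
  have h : 0 < (Finset.univ.filter fun n : Fin N → Fin 2 => ones n = k).card := by
    rw [card_ones_eq]
    exact Nat.choose_pos (Nat.le_of_lt_succ k.2)
  obtain ⟨n, hn⟩ := Finset.card_pos.mp h
  exact ⟨n, Fin.ext (Finset.mem_filter.mp hn).2⟩

lemma spinBoson_eq (N : ℕ) (lam : ℝ) :
    spinBoson N lam = ((gauss N lam).map (fun x : ℝ => (x : ℂ))).submatrix level level := rfl

lemma dfsMix_apply (N : ℕ) (α : ℝ) (j : Fin (N + 1)) (n m : Fin N → Fin 2) :
    dfsMix N α j n m = if n = m then (mixProb N α j (level n) : ℂ) else 0 := by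
  have htr : Matrix.trace (dfsProj N j) = (N.choose j : ℂ) := by
    rw [dfsProj, Matrix.trace_diagonal, Finset.sum_boole, card_ones_eq]
  by_cases h : n = m
  · subst h
    have hl : (level n = j) ↔ (ones n = (j : ℕ)) := by
      rw [Fin.ext_iff]; rfl
    rw [dfsMix, dfsDep, htr]
    simp only [Matrix.add_apply, Matrix.smul_apply, dfsProj,
      Matrix.diagonal_apply_eq, mixProb, coin, hl, Matrix.one_apply_eq, smul_eq_mul, if_true]
    split_ifs <;> push_cast <;> ring
  · simp [dfsMix, dfsDep, dfsProj, h]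

lemma coin_nonneg (N k : ℕ) : 0 ≤ coin N k := by unfold coin; positivity

lemma coin_pos {N k : ℕ} (h : k ≤ N) : 0 < coin N k := by
  have := Nat.choose_pos h
  unfold coin; positivity

lemma sum_coin (N : ℕ) : ∑ j : Fin (N + 1), coin N j = 1 := by
  rw [Fin.sum_univ_eq_sum_range (fun j => coin N j)]
  simp_rw [coin]
  rw [← Finset.sum_div, div_eq_one_iff_eq (by positivity)]
  exact_mod_cast Nat.sum_range_choose N

lemma mixProb_nonneg {N : ℕ} {α : ℝ} (h0 : 0 ≤ α) (h1 : α ≤ 1) (j k : Fin (N + 1)) :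
    0 ≤ mixProb N α j k := by
  have := mul_nonneg (sub_nonneg.2 h1) (coin_nonneg N j)
  unfold mixProb
  split_ifs <;> linarith

lemma sum_mixProb (N : ℕ) (α : ℝ) (k : Fin (N + 1)) : ∑ j, mixProb N α j k = 1 := by
  simp [mixProb, Finset.sum_add_distrib, ← Finset.mul_sum, sum_coin]

lemma isPOVM_dfsMix {N : ℕ} {α : ℝ} (h0 : 0 ≤ α) (h1 : α ≤ 1) : IsPOVM (dfsMix N α) := by
  have hd : ∀ j, dfsMix N α j = Matrix.diagonal fun n => (mixProb N α j (level n) : ℂ) := by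
    intro j; ext n m; rw [dfsMix_apply, Matrix.diagonal_apply]
  refine ⟨fun j => ?_, ?_⟩
  · rw [hd, Matrix.posSemidef_diagonal_iff]
    intro n
    exact_mod_cast mixProb_nonneg h0 h1 _ _
  · ext n m
    simp_rw [Matrix.sum_apply, dfsMix_apply, Matrix.one_apply]
    split_ifs
    · exact_mod_cast sum_mixProb N α (level n)
    · simp

lemma isIncoherent_dfsMix (N : ℕ) (α : ℝ) : IsIncoherent (dfsMix N α) := by
  intro j n m h
  rw [dfsMix_apply, if_neg h]

lemma posSemidef_map_ofReal {ι : Type*} [Fintype ι] {A : Matrix ι ι ℝ} (hA : A.PosSemidef) :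
    (A.map (fun x : ℝ => (x : ℂ))).PosSemidef := by
  classical
  obtain ⟨B, rfl⟩ : ∃ B : Matrix ι ι ℝ, A = Bᴴ * B := by
    open scoped MatrixOrder in
    obtain ⟨B, hB⟩ := CStarAlgebra.nonneg_iff_eq_star_mul_self.mp hA.nonneg
    exact ⟨B, hB⟩
  have : (Bᴴ * B).map (fun x : ℝ => (x : ℂ)) =
      (B.map (fun x : ℝ => (x : ℂ)))ᴴ * B.map (fun x : ℝ => (x : ℂ)) := by
    ext i j
    simp [Matrix.mul_apply]
  rw [this]
  exact Matrix.posSemidef_conjTranspose_mul_self _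

lemma posSemidef_map_re {ι : Type*} [Fintype ι] {A : Matrix ι ι ℂ} (hA : A.PosSemidef) :
    (A.map Complex.re).PosSemidef := by
  refine Matrix.PosSemidef.of_dotProduct_mulVec_nonneg ?_ fun x => ?_
  · ext i j
    have := congrFun (congrFun hA.isHermitian i) j
    rw [Matrix.conjTranspose_apply] at this
    rw [Matrix.conjTranspose_apply, Matrix.map_apply, Matrix.map_apply, ← this]
    simp
  · have h := hA.dotProduct_mulVec_nonneg (fun i => (x i : ℂ))
    have h2 := (Complex.le_def.mp h).1
    refine h2.trans_eq ?_
    simp [dotProduct, Matrix.mulVec]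

/-- Both matrices depend on a bit string only through its level. A splitting on levels is pulled
back along `level`; conversely one bit string per level is selected, and real parts suffice because
the target is real. -/
theorem mem_compatWeights_iff {N : ℕ} {lam α : ℝ} :
    α ∈ compatWeights N lam ↔ α ∈ Set.Icc (0 : ℝ) 1 ∧ Splits N α lam := by
  unfold compatWeights
  rw [Set.mem_ofPred_eq, and_congr_right_iff]
  intro hα
  rw [mem_compatSet_iff]
  constructor
  · rintro ⟨-, -, D, hD, hDC, hDP⟩
    choose rep hrep using level_surjective N
    refine ⟨fun j => ((D j).map Complex.re).submatrix rep rep,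
      fun j => (posSemidef_map_re (hD j)).submatrix _, ?_, fun j k => ?_⟩
    · ext k l
      have := congrArg Complex.re (congrFun (congrFun hDC (rep k)) (rep l))
      rw [spinBoson_eq] at this
      simpa [Matrix.sum_apply, hrep] using this
    · have := congrArg Complex.re (hDP j (rep k))
      rw [dfsMix_apply] at this
      simpa [hrep] using this
  · rintro ⟨C, hC, hCs, hCd⟩
    refine ⟨isPOVM_dfsMix hα.1 hα.2, isIncoherent_dfsMix N α,
      fun j => ((C j).map (fun x : ℝ => (x : ℂ))).submatrix level level,
      fun j => (posSemidef_map_ofReal (hC j)).submatrix _, ?_, fun j n => ?_⟩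
    · rw [spinBoson_eq, ← hCs]
      ext n m
      simp [Matrix.sum_apply]
    · simp [dfsMix_apply, hCd]

/-- A splitting of the coherence matrix yields a genuinely incoherent instrument. -/
theorem Splits.exists_instrument {N : ℕ} {α lam : ℝ} (h : Splits N α lam) :
    ∃ I : Fin (N + 1) → (Matrix (Fin N → Fin 2) (Fin N → Fin 2) ℂ →ₗ[ℂ]
        Matrix (Fin N → Fin 2) (Fin N → Fin 2) ℂ),
      IsGII I ∧ HasCoherenceMatrix I (spinBoson N lam) ∧ Measures I (dfsMix N α) := by
  obtain ⟨C, hC, hCs, hCd⟩ := h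
  let D : Fin (N + 1) → Matrix (Fin N → Fin 2) (Fin N → Fin 2) ℂ :=
    fun j => ((C j).map (fun x : ℝ => (x : ℂ))).submatrix level level
  have hD : ∀ j, (D j).PosSemidef := fun j => (posSemidef_map_ofReal (hC j)).submatrix _
  -- Hadamard multiplication by a positive semidefinite matrix is completely positive by Schur's
  -- theorem. As `spinBoson` is symmetric, the dual channel multiplies by the same matrix.
  let I : Fin (N + 1) → (Matrix (Fin N → Fin 2) (Fin N → Fin 2) ℂ →ₗ[ℂ]
        Matrix (Fin N → Fin 2) (Fin N → Fin 2) ℂ) := fun j =>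
    { toFun := fun ρ => D j ⊙ ρ
      map_add' := fun ρ σ => Matrix.hadamard_add _ _ _
      map_smul' := fun c ρ => Matrix.hadamard_smul _ _ _ }
  have hI : ∀ j ρ n m, I j ρ n m = D j n m * ρ n m := fun j ρ n m => rfl
  have hsum : ∀ ρ, ∑ j, I j ρ = spinBoson N lam ⊙ ρ := by
    intro ρ
    ext n m
    simp_rw [Matrix.sum_apply, hI, ← Finset.sum_mul]
    rw [spinBoson_eq, ← hCs]
    simp [Matrix.sum_apply, D]
  have hdiag : ∀ n, spinBoson N lam n n = 1 := fun n => by simp [spinBoson]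
  have hsymm : ∀ n m, spinBoson N lam n m = spinBoson N lam m n := fun n m => by
    simp only [spinBoson, Matrix.of_apply]
    rw [← Int.natAbs_neg, neg_sub]
  refine ⟨I, ⟨⟨fun j k X hX => ?_, fun ρ => ?_⟩, fun n => ?_⟩, fun X ρ => ?_, fun j ρ => ?_⟩
  · have : (Matrix.of fun p q : Fin k × (Fin N → Fin 2) =>
        I j (Matrix.of fun a b => X (p.1, a) (q.1, b)) p.2 q.2) =
        (D j).submatrix Prod.snd Prod.snd ⊙ X := by
      ext p q
      simp [hI]
    rw [this]
    exact ((hD j).submatrix _).hadamard hX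
  · rw [hsum]
    simp [Matrix.trace, hdiag]
  · rw [hsum]
    ext a b
    by_cases ha : n = a ∧ n = b
    · obtain ⟨rfl, rfl⟩ := ha
      simp [hdiag]
    · simp [ha]
  · rw [hsum]
    simp only [Matrix.trace, Matrix.diag_apply, Matrix.mul_apply, Matrix.hadamard_apply]
    refine Finset.sum_congr rfl fun n _ => Finset.sum_congr rfl fun m _ => ?_
    rw [hsymm n m]; ring
  · simp only [Matrix.trace, Matrix.diag_apply, Matrix.mul_apply, hI]
    refine Finset.sum_congr rfl fun n _ => ?_
    simp [dfsMix_apply, D, hCd]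

/-! ### Real positive semidefinite matrices -/

lemma _root_.Matrix.PosSemidef.symm_apply {n : Type*} {A : Matrix n n ℝ} (hA : A.PosSemidef) (k l : n) :
    A k l = A l k := by
  simpa using hA.isHermitian.apply l k

lemma _root_.Matrix.PosSemidef.sq_apply_le {n : Type*} {A : Matrix n n ℝ} (hA : A.PosSemidef) (k l : n) :
    A k l ^ 2 ≤ A k k * A l l := by
  have h := (hA.submatrix ![k, l]).det_nonneg
  rw [Matrix.det_fin_two] at h
  simp only [Matrix.submatrix_apply, Matrix.cons_val_zero, Matrix.cons_val_one] at h
  rw [hA.symm_apply l k] at h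
  nlinarith

section Real

variable {n : Type*} [Fintype n]

lemma dotProduct_mulVec_eq_sum (A : Matrix n n ℝ) (x : n → ℝ) :
    x ⬝ᵥ (A *ᵥ x) = ∑ k, ∑ l, A k l * x k * x l := by
  simp only [dotProduct, Matrix.mulVec, Finset.mul_sum]
  refine Finset.sum_congr rfl fun k _ => Finset.sum_congr rfl fun l _ => ?_
  ring

lemma posSemidef_of_symm_of_nonneg {A : Matrix n n ℝ} (hs : ∀ k l, A k l = A l k)
    (h : ∀ x : n → ℝ, 0 ≤ ∑ k, ∑ l, A k l * x k * x l) : A.PosSemidef := by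
  refine Matrix.PosSemidef.of_dotProduct_mulVec_nonneg ?_ fun x => ?_
  · ext k l
    simpa using hs l k
  · rw [star_trivial, dotProduct_mulVec_eq_sum]
    exact h x

lemma _root_.Matrix.PosSemidef.sum_nonneg {A : Matrix n n ℝ} (hA : A.PosSemidef) (x : n → ℝ) :
    0 ≤ ∑ k, ∑ l, A k l * x k * x l := by
  rw [← dotProduct_mulVec_eq_sum]
  simpa using hA.dotProduct_mulVec_nonneg x

/-- A positive definite form is bounded below by a multiple of the squared norm. -/
lemma _root_.Matrix.PosDef.exists_lower_bound [Nonempty n] {A : Matrix n n ℝ} (hA : A.PosDef) :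
    ∃ δ > 0, ∀ x : n → ℝ, δ * ‖x‖ ^ 2 ≤ ∑ k, ∑ l, A k l * x k * x l := by
  have hcont : Continuous fun x : n → ℝ => ∑ k, ∑ l, A k l * x k * x l := by fun_prop
  obtain ⟨y, hy, hmin⟩ := (isCompact_sphere (0 : n → ℝ) 1).exists_isMinOn
    ((NormedSpace.sphere_nonempty (x := (0 : n → ℝ)) (r := 1)).2 zero_le_one) hcont.continuousOn
  have hy0 : y ≠ 0 := by
    rintro rfl
    simp at hy
  refine ⟨∑ k, ∑ l, A k l * y k * y l, ?_, fun x => ?_⟩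
  · rw [← dotProduct_mulVec_eq_sum]
    simpa using hA.dotProduct_mulVec_pos hy0
  · rcases eq_or_ne x 0 with rfl | hx
    · simp
    · have hn : 0 < ‖x‖ := norm_pos_iff.2 hx
      have hmem : ‖x‖⁻¹ • x ∈ Metric.sphere (0 : n → ℝ) 1 := by
        rw [mem_sphere_zero_iff_norm, norm_smul, norm_inv, norm_norm, inv_mul_cancel₀ hn.ne']
      have := hmin hmem
      simp only [Set.mem_ofPred_eq, Pi.smul_apply, smul_eq_mul] at this
      have h2 : ∑ k, ∑ l, A k l * (‖x‖⁻¹ * x k) * (‖x‖⁻¹ * x l) =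
          (∑ k, ∑ l, A k l * x k * x l) * (‖x‖⁻¹) ^ 2 := by
        simp_rw [Finset.sum_mul]
        refine Finset.sum_congr rfl fun k _ => Finset.sum_congr rfl fun l _ => ?_
        ring
      rw [h2, inv_pow, ← div_eq_mul_inv, le_div_iff₀ (by positivity)] at this
      exact this

lemma abs_sum_mul_le (B : Matrix n n ℝ) (x : n → ℝ) :
    |∑ k, ∑ l, B k l * x k * x l| ≤ (∑ k, ∑ l, |B k l|) * ‖x‖ ^ 2 := by
  simp_rw [Finset.sum_mul]
  refine (Finset.abs_sum_le_sum_abs _ _).trans (Finset.sum_le_sum fun k _ => ?_)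
  refine (Finset.abs_sum_le_sum_abs _ _).trans (Finset.sum_le_sum fun l _ => ?_)
  have h1 : |x k| ≤ ‖x‖ := norm_le_pi_norm x k
  have h2 : |x l| ≤ ‖x‖ := norm_le_pi_norm x l
  rw [abs_mul, abs_mul, mul_assoc, pow_two]
  gcongr

end Real

/-! ### The Gaussian matrix -/

lemma gauss_apply (N : ℕ) (lam : ℝ) (k l : Fin (N + 1)) :
    gauss N lam k l = lam ^ (((k : ℤ) - (l : ℤ)).natAbs ^ 2) := rfl

lemma gauss_symm (N : ℕ) (lam : ℝ) (k l : Fin (N + 1)) : gauss N lam k l = gauss N lam l k := by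
  rw [gauss_apply, gauss_apply, ← Int.natAbs_neg, neg_sub]

@[simp] lemma gauss_diag (N : ℕ) (lam : ℝ) (k : Fin (N + 1)) : gauss N lam k k = 1 := by
  simp [gauss_apply]

lemma gauss_mul (N : ℕ) (lam mu : ℝ) : gauss N (lam * mu) = gauss N lam ⊙ gauss N mu := by
  ext k l
  simp [gauss_apply, mul_pow]

lemma gauss_zero (N : ℕ) : gauss N 0 = 1 := by
  ext k l
  rw [gauss_apply, Matrix.one_apply]
  split_ifs with h
  · simp [h]
  · have : (k : ℤ) - l ≠ 0 := by
      rw [sub_ne_zero]; exact_mod_cast fun h' => h (Fin.ext h')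
    exact zero_pow (pow_ne_zero 2 (Int.natAbs_ne_zero.2 this))

/-- The exponential kernel `exp (t k l)`. -/
noncomputable def expKernel (N : ℕ) (t : ℝ) : Matrix (Fin (N + 1)) (Fin (N + 1)) ℝ :=
  Matrix.of fun k l => Real.exp (t * ((k : ℝ) * (l : ℝ)))

/-- Each term of the exponential series contributes the nonnegative form `t ^ m / m! * (∑ k ^ m * x
k) ^ 2`. -/
lemma expKernel_posSemidef (N : ℕ) {t : ℝ} (ht : 0 ≤ t) : (expKernel N t).PosSemidef := by
  refine posSemidef_of_symm_of_nonneg (fun k l => ?_) fun x => ?_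
  · simp [expKernel, mul_comm]
  · have h : ∀ k l : Fin (N + 1), HasSum
        (fun m : ℕ => (t * ((k : ℝ) * (l : ℝ))) ^ m / (m.factorial : ℝ) * x k * x l)
        (expKernel N t k l * x k * x l) := fun k l => by
      have := NormedSpace.expSeries_div_hasSum_exp (t * ((k : ℝ) * (l : ℝ)))
      rw [← Real.exp_eq_exp_ℝ] at this
      exact (this.mul_right _).mul_right _
    have hs := hasSum_sum (s := Finset.univ) fun k _ =>
      hasSum_sum (s := Finset.univ) fun l _ => h k l
    refine hs.nonneg fun m => ?_
    have : ∑ k : Fin (N + 1), ∑ l : Fin (N + 1),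
        (t * ((k : ℝ) * (l : ℝ))) ^ m / (m.factorial : ℝ) * x k * x l =
        t ^ m / (m.factorial : ℝ) * (∑ k : Fin (N + 1), (k : ℝ) ^ m * x k) ^ 2 := by
      rw [pow_two, Finset.sum_mul_sum, Finset.mul_sum]
      refine Finset.sum_congr rfl fun k _ => ?_
      rw [Finset.mul_sum]
      refine Finset.sum_congr rfl fun l _ => ?_
      rw [mul_pow, mul_pow]; ring
    rw [this]
    positivity

lemma expKernel_det_ne_zero (N : ℕ) {t : ℝ} (ht : 0 < t) : (expKernel N t).det ≠ 0 := by
  have : expKernel N t = Matrix.vandermonde fun k : Fin (N + 1) => Real.exp (t * k) := by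
    ext k l
    rw [Matrix.vandermonde_apply, ← Real.exp_nat_mul]
    simp only [expKernel, Matrix.of_apply]
    ring_nf
  rw [this, Matrix.det_vandermonde_ne_zero_iff]
  intro k l h
  have h1 := Real.exp_injective h
  have h2 := mul_left_cancel₀ ht.ne' h1
  exact Fin.ext (by exact_mod_cast h2)

/-- This is `(k - l)² = k² + l² - 2kl` in the exponent: up to a diagonal congruence the Gaussian
matrix is an exponential kernel. -/
lemma gauss_eq_mul (N : ℕ) {lam : ℝ} (h : 0 < lam) :
    gauss N lam = (Matrix.diagonal fun k : Fin (N + 1) => lam ^ ((k : ℕ) ^ 2))ᴴ *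
      expKernel N (-2 * Real.log lam) * Matrix.diagonal fun k : Fin (N + 1) => lam ^ ((k : ℕ) ^ 2) := by
  ext k l
  rw [Matrix.diagonal_conjTranspose, Matrix.mul_diagonal, Matrix.diagonal_mul, gauss_apply]
  simp only [expKernel, Matrix.of_apply, star_trivial]
  have h1 : Real.exp (-2 * Real.log lam * ((k : ℝ) * (l : ℝ))) = lam ^ (-(2 * (k : ℤ) * l)) := by
    rw [← Real.rpow_intCast, Real.rpow_def_of_pos h]
    push_cast
    ring_nf
  rw [h1, ← zpow_natCast, ← zpow_natCast, ← zpow_natCast]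
  rw [← zpow_add₀ h.ne', ← zpow_add₀ h.ne']
  congr 1
  push_cast
  rw [sq_abs]
  ring

lemma gauss_posSemidef (N : ℕ) {lam : ℝ} (h0 : 0 ≤ lam) (h1 : lam ≤ 1) :
    (gauss N lam).PosSemidef := by
  rcases h0.eq_or_lt with rfl | h
  · rw [gauss_zero]; exact Matrix.PosSemidef.one
  · rw [gauss_eq_mul N h]
    refine (expKernel_posSemidef N ?_).conjTranspose_mul_mul_same _
    have := Real.log_nonpos h0 h1
    linarith

lemma gauss_posDef (N : ℕ) {lam : ℝ} (h0 : 0 ≤ lam) (h1 : lam < 1) : (gauss N lam).PosDef := by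
  rcases h0.eq_or_lt with rfl | h
  · rw [gauss_zero]; exact Matrix.PosDef.one
  · rw [(gauss_posSemidef N h0 h1.le).posDef_iff_det_ne_zero, gauss_eq_mul N h, Matrix.det_mul,
      Matrix.det_mul, Matrix.det_conjTranspose, Matrix.det_diagonal]
    have hl := Real.log_neg h h1
    have hp : (∏ k : Fin (N + 1), lam ^ ((k : ℕ) ^ 2)) ≠ 0 :=
      Finset.prod_ne_zero_iff.2 fun k _ => pow_ne_zero _ h.ne'
    exact mul_ne_zero (mul_ne_zero (star_ne_zero.2 hp)
      (expKernel_det_ne_zero N (by linarith))) hp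

/-! ### Moving along the compatibility region -/

section Region

variable {N : ℕ} {α lam : ℝ}

lemma splits_zero_left (h0 : 0 ≤ lam) (h1 : lam ≤ 1) : Splits N 0 lam := by
  refine ⟨fun j => coin N j • gauss N lam,
    fun j => (gauss_posSemidef N h0 h1).smul (coin_nonneg N j), ?_, fun j k => ?_⟩
  · rw [← Finset.sum_smul, sum_coin, one_smul]
  · simp [mixProb]

lemma splits_zero_right (h0 : 0 ≤ α) (h1 : α ≤ 1) : Splits N α 0 := by
  refine ⟨fun j => Matrix.diagonal (mixProb N α j), fun j => ?_, ?_, fun j k => by simp⟩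
  · exact Matrix.posSemidef_diagonal_iff.2 fun k => mixProb_nonneg h0 h1 j k
  · rw [gauss_zero]
    ext k l
    rw [Matrix.sum_apply, Matrix.one_apply]
    split_ifs with h
    · subst h; simp [sum_mixProb]
    · simp [h]

/-- Adding a suitable fraction of a positive semidefinite difference. -/
lemma Splits.add_remainder {t lam' : ℝ} (h : Splits N α lam) (ht : 0 ≤ t)
    (hR : (gauss N lam' - t • gauss N lam).PosSemidef) : Splits N (t * α) lam' := by
  obtain ⟨C, hC, hCs, hCd⟩ := h
  refine ⟨fun j => t • C j + coin N j • (gauss N lam' - t • gauss N lam),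
    fun j => ((hC j).smul ht).add (hR.smul (coin_nonneg N j)), ?_, fun j k => ?_⟩
  · rw [Finset.sum_add_distrib, ← Finset.smul_sum, ← Finset.sum_smul, hCs, sum_coin, one_smul]
    abel
  · simp only [Matrix.add_apply, Matrix.smul_apply, Matrix.sub_apply, gauss_diag, hCd, mixProb,
      smul_eq_mul]
    split_ifs <;> ring

lemma Splits.mono_weight {α' : ℝ} (h : Splits N α lam) (h0 : 0 ≤ lam) (h1 : lam ≤ 1)
    (hα' : 0 ≤ α') (hle : α' ≤ α) : Splits N α' lam := by
  rcases hα'.eq_or_lt with rfl | hpos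
  · exact splits_zero_left h0 h1
  · have hα : 0 < α := hpos.trans_le hle
    have := h.add_remainder (lam' := lam) (t := α' / α) (by positivity) (by
      have : gauss N lam - (α' / α) • gauss N lam = (1 - α' / α) • gauss N lam := by
        rw [sub_smul, one_smul]
      rw [this]
      exact (gauss_posSemidef N h0 h1).smul (sub_nonneg.2 ((div_le_one hα).2 hle)))
    rwa [div_mul_cancel₀ _ hα.ne'] at this

/-- `gauss` is multiplicative in `lam` for the Hadamard product, so every part can be damped by the
positive semidefinite `gauss N (lam' / lam)`, whose diagonal is `1`. -/
lemma Splits.mono_right {lam' : ℝ} (h : Splits N α lam) (hlam' : 0 ≤ lam') (hle : lam' ≤ lam)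
    (hα0 : 0 ≤ α) (hα1 : α ≤ 1) : Splits N α lam' := by
  rcases hlam'.eq_or_lt with rfl | hpos
  · exact splits_zero_right hα0 hα1
  · have hl : 0 < lam := hpos.trans_le hle
    obtain ⟨C, hC, hCs, hCd⟩ := h
    have hg : gauss N lam' = gauss N lam ⊙ gauss N (lam' / lam) := by
      rw [← gauss_mul, mul_div_cancel₀ _ hl.ne']
    refine ⟨fun j => C j ⊙ gauss N (lam' / lam), fun j => (hC j).hadamard
      (gauss_posSemidef N (by positivity) ((div_le_one hl).2 hle)), ?_, fun j k => ?_⟩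
    · rw [hg, ← hCs]
      ext k l
      simp [Matrix.sum_apply, Finset.sum_mul]
    · simp [hCd]

/-- Decreasing `lam` makes room for a strictly larger weight. -/
lemma Splits.exists_larger_weight {lam' : ℝ} (h : Splits N α lam) (hlam' : 0 ≤ lam')
    (hlt : lam' < lam) :
    ∃ t : ℝ, 0 < t ∧ t ≤ 1 ∧ Splits N ((1 - t) * α + t) lam' := by
  have hl : 0 < lam := hlam'.trans_lt hlt
  obtain ⟨C, hC, hCs, hCd⟩ := h
  have hg : gauss N lam' = gauss N lam ⊙ gauss N (lam' / lam) := by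
    rw [← gauss_mul, mul_div_cancel₀ _ hl.ne']
  obtain ⟨δ, hδ, hlow⟩ := (gauss_posDef N (lam := lam' / lam) (by positivity)
    ((div_lt_one hl).2 hlt)).exists_lower_bound
  -- The norm is the sup norm, and `∑ x k ^ 2 ≤ (N + 1) * ‖x‖ ^ 2`; hence this choice makes `gauss -
  -- t • 1` positive semidefinite.
  obtain ⟨t, ht0, ht1, htδ⟩ : ∃ t : ℝ, 0 < t ∧ t ≤ 1 ∧ t * (N + 1) ≤ δ := by
    refine ⟨min 1 (δ / (N + 1)), by positivity, min_le_left _ _, ?_⟩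
    calc min 1 (δ / (N + 1)) * ((N : ℝ) + 1) ≤ δ / (N + 1) * (N + 1) := by
          gcongr; exact min_le_right _ _
      _ = δ := by field_simp
  have hR : (gauss N (lam' / lam) - t • (1 : Matrix (Fin (N + 1)) (Fin (N + 1)) ℝ)).PosSemidef := by
    refine posSemidef_of_symm_of_nonneg (fun k l => ?_) fun x => ?_
    · simp only [Matrix.sub_apply, Matrix.smul_apply, gauss_symm N _ k l, Matrix.one_apply,
        eq_comm (a := k)]
    · have h1 : ∑ k, ∑ l, (gauss N (lam' / lam) - t • (1 : Matrix (Fin (N + 1)) (Fin (N + 1)) ℝ)) k l * x k * x l =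
          (∑ k, ∑ l, gauss N (lam' / lam) k l * x k * x l) - t * ∑ k, x k ^ 2 := by
        simp [Matrix.one_apply, sub_mul, Finset.sum_sub_distrib, Finset.mul_sum, ite_mul, pow_two,
          mul_assoc]
      have h2 : ∑ k, x k ^ 2 ≤ (N + 1) * ‖x‖ ^ 2 := by
        calc ∑ k, x k ^ 2 ≤ ∑ _k : Fin (N + 1), ‖x‖ ^ 2 := Finset.sum_le_sum fun k _ => by
              rw [← sq_abs]
              have : |x k| ≤ ‖x‖ := norm_le_pi_norm x k
              gcongr
          _ = (N + 1) * ‖x‖ ^ 2 := by simp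
      have h3 := hlow x
      have h4 : t * ∑ k, x k ^ 2 ≤ t * ((N + 1) * ‖x‖ ^ 2) := by gcongr
      have h5 : t * (N + 1) * ‖x‖ ^ 2 ≤ δ * ‖x‖ ^ 2 := by gcongr
      rw [h1]
      linarith
  -- The diagonal mass `t` taken out of the damping matrix is returned as a sharp measurement of the
  -- level, which raises the weight to `(1 - t) * α + t`.
  refine ⟨t, ht0, ht1, fun j => C j ⊙ (gauss N (lam' / lam) - t • (1 : Matrix (Fin (N + 1)) (Fin (N + 1)) ℝ)) +
    t • Matrix.diagonal (fun k => if k = j then (1 : ℝ) else 0), fun j => ?_, ?_, fun j k => ?_⟩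
  · refine ((hC j).hadamard hR).add (Matrix.PosSemidef.smul ?_ ht0.le)
    exact Matrix.posSemidef_diagonal_iff.2 fun k => by split_ifs <;> norm_num
  · have hkl : ∀ k l, ∑ j, C j k l = gauss N lam k l := fun k l => by
      rw [← hCs, Matrix.sum_apply]
    ext k l
    rw [hg]
    simp only [Matrix.sum_apply, Matrix.add_apply, Matrix.hadamard_apply, Matrix.sub_apply,
      Matrix.smul_apply, smul_eq_mul, Finset.sum_add_distrib, ← Finset.sum_mul,
      ← Finset.mul_sum, hkl]
    rcases eq_or_ne k l with rfl | hne
    · simp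
    · simp [hne]
  · simp only [Matrix.add_apply, Matrix.hadamard_apply, Matrix.sub_apply, gauss_diag,
      Matrix.smul_apply, Matrix.one_apply_eq, Matrix.diagonal_apply_eq, hCd, mixProb, smul_eq_mul]
    split_ifs <;> ring

/-- Decreasing the weight makes room for a strictly larger `lam`. -/
lemma Splits.exists_larger_right {t : ℝ} (h : Splits N α lam) (h0 : 0 ≤ lam) (h1 : lam < 1)
    (ht0 : 0 ≤ t) (ht1 : t < 1) : ∃ lam' : ℝ, lam < lam' ∧ lam' ≤ 1 ∧ Splits N (t * α) lam' := by
  obtain ⟨δ, hδ, hlow⟩ := (gauss_posDef N h0 h1).exists_lower_bound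
  have hcont : Continuous fun mu : ℝ =>
      ∑ k : Fin (N + 1), ∑ l : Fin (N + 1), |gauss N mu k l - gauss N lam k l| := by
    simp only [gauss_apply]
    fun_prop
  -- For `mu` near `lam` the change of the form is dominated by the reserve `(1 - t) • gauss N lam`,
  -- which is positive definite.
  have hev : ∀ᶠ mu in 𝓝[>] lam,
      ∑ k : Fin (N + 1), ∑ l : Fin (N + 1), |gauss N mu k l - gauss N lam k l| < (1 - t) * δ := by
    refine (hcont.tendsto lam).mono_left nhdsWithin_le_nhds |>.eventually_lt_const ?_
    simpa using mul_pos (sub_pos.2 ht1) hδ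
  obtain ⟨mu, hmu, hmem⟩ := (hev.and (Ioc_mem_nhdsGT h1)).exists
  refine ⟨mu, hmem.1, hmem.2, h.add_remainder ht0 ?_⟩
  refine posSemidef_of_symm_of_nonneg (fun k l => ?_) fun x => ?_
  · simp only [Matrix.sub_apply, Matrix.smul_apply, gauss_symm N _ k l]
  · have e1 : ∑ k, ∑ l, (gauss N mu - t • gauss N lam) k l * x k * x l =
        (∑ k, ∑ l, (gauss N mu - gauss N lam) k l * x k * x l) +
          (1 - t) * ∑ k, ∑ l, gauss N lam k l * x k * x l := by
      simp_rw [Finset.mul_sum, ← Finset.sum_add_distrib]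
      refine Finset.sum_congr rfl fun k _ => Finset.sum_congr rfl fun l _ => ?_
      simp only [Matrix.sub_apply, Matrix.smul_apply, smul_eq_mul]
      ring
    have e2 := (abs_le.1 (abs_sum_mul_le (gauss N mu - gauss N lam) x)).1
    simp only [Matrix.sub_apply] at e2
    have e3 := mul_le_mul_of_nonneg_left (hlow x) (sub_pos.2 ht1).le
    have e4 := mul_le_mul_of_nonneg_right hmu.le (sq_nonneg ‖x‖)
    rw [e1]
    simp only [Matrix.sub_apply]
    linarith

/-- The region of compatible pairs is compact. -/
lemma isCompact_splits (N : ℕ) :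
    IsCompact {p : ℝ × ℝ | p.1 ∈ Set.Icc (0 : ℝ) 1 ∧ p.2 ∈ Set.Icc (0 : ℝ) 1 ∧
      Splits N p.1 p.2} := by
  -- The splitting itself is carried along as a coordinate. Closed conditions then define `T`, and
  -- the region is its projection.
  let T : Set (ℝ × ℝ × (Fin (N + 1) → Fin (N + 1) → Fin (N + 1) → ℝ)) :=
    {p | p.1 ∈ Set.Icc (0 : ℝ) 1 ∧ p.2.1 ∈ Set.Icc (0 : ℝ) 1 ∧
      (∀ j k l, p.2.2 j k l = p.2.2 j l k) ∧
      (∀ j (x : Fin (N + 1) → ℝ), 0 ≤ ∑ k, ∑ l, p.2.2 j k l * x k * x l) ∧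
      (∀ k l, ∑ j, p.2.2 j k l = gauss N p.2.1 k l) ∧
      ∀ j k, p.2.2 j k k = mixProb N p.1 j k}
  have hpsd : ∀ p ∈ T, ∀ j, (Matrix.of (p.2.2 j)).PosSemidef := fun p hp j =>
    posSemidef_of_symm_of_nonneg (hp.2.2.1 j) (hp.2.2.2.1 j)
  have hclosed : IsClosed T := by
    have hgc : ∀ k l : Fin (N + 1), Continuous fun mu : ℝ => gauss N mu k l := fun k l => by
      simp only [gauss_apply]; fun_prop
    have hmc : ∀ j k : Fin (N + 1), Continuous fun a : ℝ => mixProb N a j k := fun j k => by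
      unfold mixProb; split_ifs <;> fun_prop
    have c1 : ∀ j k l : Fin (N + 1), Continuous
        fun p : ℝ × ℝ × (Fin (N + 1) → Fin (N + 1) → Fin (N + 1) → ℝ) => p.2.2 j k l :=
      fun j k l => by fun_prop
    have k1 : IsClosed {p : ℝ × ℝ × (Fin (N + 1) → Fin (N + 1) → Fin (N + 1) → ℝ) |
        ∀ j k l, p.2.2 j k l = p.2.2 j l k} := by
      simp only [Set.ofPred_forall]
      exact isClosed_iInter fun j => isClosed_iInter fun k => isClosed_iInter fun l =>
        isClosed_eq (c1 j k l) (c1 j l k)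
    have k2 : IsClosed {p : ℝ × ℝ × (Fin (N + 1) → Fin (N + 1) → Fin (N + 1) → ℝ) |
        ∀ j (x : Fin (N + 1) → ℝ), 0 ≤ ∑ k, ∑ l, p.2.2 j k l * x k * x l} := by
      simp only [Set.ofPred_forall]
      exact isClosed_iInter fun j => isClosed_iInter fun x => isClosed_le continuous_const
        (continuous_finsetSum _ fun k _ => continuous_finsetSum _ fun l _ =>
          ((c1 j k l).mul continuous_const).mul continuous_const)
    have k3 : IsClosed {p : ℝ × ℝ × (Fin (N + 1) → Fin (N + 1) → Fin (N + 1) → ℝ) |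
        ∀ k l, ∑ j, p.2.2 j k l = gauss N p.2.1 k l} := by
      simp only [Set.ofPred_forall]
      exact isClosed_iInter fun k => isClosed_iInter fun l => isClosed_eq
        (continuous_finsetSum _ fun j _ => c1 j k l)
        ((hgc k l).comp (continuous_fst.comp continuous_snd))
    have k4 : IsClosed {p : ℝ × ℝ × (Fin (N + 1) → Fin (N + 1) → Fin (N + 1) → ℝ) |
        ∀ j k, p.2.2 j k k = mixProb N p.1 j k} := by
      simp only [Set.ofPred_forall]
      exact isClosed_iInter fun j => isClosed_iInter fun k => isClosed_eq (c1 j k k)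
        ((hmc j k).comp continuous_fst)
    exact (isClosed_Icc.preimage continuous_fst).inter ((isClosed_Icc.preimage
      (continuous_fst.comp continuous_snd)).inter (k1.inter (k2.inter (k3.inter k4))))
  -- Diagonal entries are probabilities, so the `2 × 2` minors confine all entries to `[-1, 1]`.
  have hcompact : IsCompact T := by
    refine ((isCompact_Icc (a := (0 : ℝ)) (b := 1)).prod
      ((isCompact_Icc (a := (0 : ℝ)) (b := 1)).prod (isCompact_univ_pi
        fun _ : Fin (N + 1) => isCompact_univ_pi fun _ : Fin (N + 1) => isCompact_univ_pi
          fun _ : Fin (N + 1) => isCompact_Icc (a := (-1 : ℝ)) (b := 1)))).of_isClosed_subset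
      hclosed fun p hp => ⟨hp.1, hp.2.1, fun j _ k _ l _ => ?_⟩
    have hle : ∀ j k, p.2.2 j k k ≤ 1 := fun j k => by
      rw [hp.2.2.2.2.2 j k, ← sum_mixProb N p.1 k]
      exact Finset.single_le_sum (f := fun j => mixProb N p.1 j k)
        (fun i _ => mixProb_nonneg hp.1.1 hp.1.2 i k) (Finset.mem_univ j)
    have hge : ∀ j k, 0 ≤ p.2.2 j k k := fun j k => by
      rw [hp.2.2.2.2.2 j k]
      exact mixProb_nonneg hp.1.1 hp.1.2 j k
    have hsq := (hpsd p hp j).sq_apply_le k l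
    simp only [Matrix.of_apply] at hsq
    exact abs_le.1 (abs_le_one_iff_mul_self_le_one.2
      (by nlinarith [mul_le_one₀ (hle j k) (hge j l) (hle j l)]))
  have himage : {p : ℝ × ℝ | p.1 ∈ Set.Icc (0 : ℝ) 1 ∧ p.2 ∈ Set.Icc (0 : ℝ) 1 ∧
      Splits N p.1 p.2} = (fun p => (p.1, p.2.1)) '' T := by
    ext ⟨a, b⟩
    constructor
    · rintro ⟨ha, hb, C, hC, hCs, hCd⟩
      exact ⟨(a, b, C), ⟨ha, hb, fun j k l => (hC j).symm_apply k l, fun j x => (hC j).sum_nonneg x,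
        fun k l => by rw [← hCs, Matrix.sum_apply], hCd⟩, rfl⟩
    · rintro ⟨p, hp, h⟩
      obtain ⟨rfl, rfl⟩ := Prod.mk.inj h
      refine ⟨hp.1, hp.2.1, fun j => Matrix.of (p.2.2 j), hpsd p hp, ?_, hp.2.2.2.2.2⟩
      ext k l
      rw [Matrix.sum_apply]
      exact hp.2.2.2.2.1 k l
  rw [himage]
  exact hcompact.image (by fun_prop)

end Region

/-! ### The Hellinger bound -/

section Hellinger

variable {N : ℕ} {α : ℝ}

lemma beta_eq (N : ℕ) (α : ℝ) :
    beta N 0 1 α = uN N 0 α + uN N 1 α + (1 - α) * (1 - coin N 0 - coin N 1) := by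
  unfold beta uN; ring

lemma coin_zero_add_coin_one_le (hN : 1 ≤ N) : coin N 0 + coin N 1 ≤ 1 := by
  rw [← sum_coin N, Fin.sum_univ_eq_sum_range (fun j => coin N j)]
  calc coin N 0 + coin N 1 = ∑ j ∈ Finset.range 2, coin N j := by
        rw [Finset.sum_range_succ, Finset.sum_range_one]
    _ ≤ _ := Finset.sum_le_sum_of_subset_of_nonneg
        (Finset.range_subset_range.2 (by omega)) fun j _ _ => coin_nonneg N j

lemma coin_le_one (N k : ℕ) : coin N k ≤ 1 := by
  unfold coin
  rw [div_le_one (by positivity)]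
  exact_mod_cast Nat.choose_le_two_pow N k

lemma uN_sq (hα : α ∈ Set.Icc (0 : ℝ) 1) (N k : ℕ) :
    uN N k α ^ 2 = coin N k * (1 - α) * (α + coin N k * (1 - α)) := by
  have h1 := hα.1
  have := mul_nonneg (coin_nonneg N k) (sub_nonneg.2 hα.2)
  exact Real.sq_sqrt (by positivity)

lemma uN_nonneg (N k : ℕ) (α : ℝ) : 0 ≤ uN N k α := Real.sqrt_nonneg _

lemma uN_eq_mul (hα : α ∈ Set.Icc (0 : ℝ) 1) (N k : ℕ) :
    uN N k α = √(coin N k * (1 - α)) * √(α + coin N k * (1 - α)) :=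
  Real.sqrt_mul (mul_nonneg (coin_nonneg N k) (sub_nonneg.2 hα.2)) _

lemma uN_one (N k : ℕ) : uN N k 1 = 0 := by simp [uN]

lemma uN_zero (N k : ℕ) : uN N k 0 = coin N k := by
  simp [uN, Real.sqrt_mul_self (coin_nonneg N k)]

/-- This form shows the monotonicity: each difference of square roots is nonnegative and increases
with `α`. -/
lemma beta_eq_hellinger (hα : α ∈ Set.Icc (0 : ℝ) 1) : beta N 0 1 α = 1 -
    ((√(α + coin N 0 * (1 - α)) - √(coin N 0 * (1 - α))) ^ 2 +
      (√(α + coin N 1 * (1 - α)) - √(coin N 1 * (1 - α))) ^ 2) / 2 := by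
  have h0 := mul_nonneg (coin_nonneg N 0) (sub_nonneg.2 hα.2)
  have h1 := mul_nonneg (coin_nonneg N 1) (sub_nonneg.2 hα.2)
  rw [beta_eq, uN_eq_mul hα, uN_eq_mul hα]
  have e1 := Real.sq_sqrt h0
  have e2 := Real.sq_sqrt h1
  have e3 := Real.sq_sqrt (add_nonneg hα.1 h0)
  have e4 := Real.sq_sqrt (add_nonneg hα.1 h1)
  linear_combination (1 / 2) * (e1 + e2 + e3 + e4)

lemma sqrt_sub_sqrt_lt {k : ℕ} (hk : k ≤ N) {a b : ℝ} (hab : a < b) (hb : b ≤ 1) :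
    √(a + coin N k * (1 - a)) - √(coin N k * (1 - a)) <
      √(b + coin N k * (1 - b)) - √(coin N k * (1 - b)) := by
  have hc := coin_pos hk
  have hc1 := coin_le_one N k
  have h1 : √(a + coin N k * (1 - a)) ≤ √(b + coin N k * (1 - b)) :=
    Real.sqrt_le_sqrt (by nlinarith)
  have h2 : √(coin N k * (1 - b)) < √(coin N k * (1 - a)) :=
    Real.sqrt_lt_sqrt (mul_nonneg hc.le (by linarith)) (by nlinarith)
  linarith

lemma strictAntiOn_beta (hN : 1 ≤ N) : StrictAntiOn (beta N 0 1) (Set.Icc 0 1) := by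
  intro a ha b hb hab
  rw [beta_eq_hellinger ha, beta_eq_hellinger hb]
  have key : ∀ k, k ≤ N → (√(a + coin N k * (1 - a)) - √(coin N k * (1 - a))) ^ 2 <
      (√(b + coin N k * (1 - b)) - √(coin N k * (1 - b))) ^ 2 := fun k hk => by
    have hnn : 0 ≤ √(a + coin N k * (1 - a)) - √(coin N k * (1 - a)) :=
      sub_nonneg.2 (Real.sqrt_le_sqrt (by linarith [ha.1]))
    exact pow_lt_pow_left₀ (sqrt_sub_sqrt_lt hk hab hb.2) hnn two_ne_zero
  linarith [key 0 (by omega), key 1 hN]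

lemma beta_zero : beta N 0 1 0 = 1 := by
  rw [beta_eq, uN_zero, uN_zero]; ring

lemma beta_one : beta N 0 1 1 = 0 := by
  rw [beta_eq, uN_one, uN_one]; ring

lemma beta_le_one (hN : 1 ≤ N) (hα : α ∈ Set.Icc (0 : ℝ) 1) : beta N 0 1 α ≤ 1 := by
  rw [← beta_zero (N := N)]
  exact (strictAntiOn_beta hN).antitoneOn ⟨le_rfl, zero_le_one⟩ hα hα.1

lemma bijOn_beta (hN : 1 ≤ N) : Set.BijOn (beta N 0 1) (Set.Icc 0 1) (Set.Icc 0 1) := by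
  have hanti := strictAntiOn_beta hN
  refine ⟨fun a ha => ⟨?_, beta_le_one hN ha⟩, hanti.injOn, ?_⟩
  · rw [← beta_one (N := N)]
    exact hanti.antitoneOn ha ⟨zero_le_one, le_rfl⟩ ha.2
  · have hc : ContinuousOn (beta N 0 1) (Set.Icc 0 1) := by
      apply Continuous.continuousOn
      unfold beta
      fun_prop
    have := intermediate_value_Icc' (zero_le_one' ℝ) hc
    rwa [beta_zero, beta_one] at this

lemma uN_add_uN_mem (hN : 1 ≤ N) (hα : α ∈ Set.Icc (0 : ℝ) 1) :
    uN N 0 α + uN N 1 α ∈ Set.Icc (0 : ℝ) 1 := by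
  refine ⟨add_nonneg (uN_nonneg _ _ _) (uN_nonneg _ _ _), ?_⟩
  have h1 := beta_le_one hN hα
  have h2 := mul_nonneg (sub_nonneg.2 hα.2) (by linarith [coin_zero_add_coin_one_le hN] :
    0 ≤ 1 - coin N 0 - coin N 1)
  rw [beta_eq] at h1
  linarith

/-- The `2 × 2` minors bound `lam` by the Hellinger affinity of adjacent levels. -/
lemma Splits.le_beta {lam : ℝ} (h : Splits N α lam) (hN : 1 ≤ N) (hα : α ∈ Set.Icc (0 : ℝ) 1) :
    lam ≤ beta N 0 1 α := by
  obtain ⟨C, hC, hCs, hCd⟩ := h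
  let o : Fin (N + 1) := ⟨1, by omega⟩
  have h0o : (0 : Fin (N + 1)) ≠ o := by simp [o, Fin.ext_iff]
  have hl : lam = ∑ j, C j 0 o := by
    rw [← Matrix.sum_apply, hCs, gauss_apply]
    simp [o]
  have hq : ∀ j : Fin (N + 1), 0 ≤ (1 - α) * coin N j := fun j =>
    mul_nonneg (sub_nonneg.2 hα.2) (coin_nonneg N j)
  -- The bound is the geometric mean of `mixProb` at levels `0` and `1`; it differs from `(1 - α) *
  -- coin N j` only for the outcomes `0` and `1`.
  have hle : ∀ j, C j 0 o ≤ (1 - α) * coin N j +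
      ((if j = 0 then uN N 0 α - coin N 0 * (1 - α) else 0) +
      (if j = o then uN N 1 α - coin N 1 * (1 - α) else 0)) := fun j => by
    have hs := (hC j).sq_apply_le 0 o
    rw [hCd, hCd] at hs
    refine (le_abs_self _).trans (abs_le_of_sq_le_sq ?_ ?_) |>.trans_eq' rfl
    · refine hs.trans_eq ?_
      rcases eq_or_ne j 0 with rfl | hj0
      · have := uN_sq hα N 0
        simp only [mixProb, if_true, if_neg h0o, if_neg h0o.symm, Fin.val_zero]
        linear_combination -this
      · rcases eq_or_ne j o with rfl | hjo
        · have := uN_sq hα N 1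
          simp only [mixProb, if_true, if_neg h0o, if_neg h0o.symm]
          simp only [o]
          linear_combination -this
        · simp only [mixProb, if_neg hj0, if_neg hjo, if_neg hj0.symm, if_neg hjo.symm]
          ring
    · have := hq j
      rcases eq_or_ne j 0 with rfl | hj0
      · have := uN_nonneg N 0 α
        simp only [if_true, if_neg h0o, Fin.val_zero]
        linarith
      · rcases eq_or_ne j o with rfl | hjo
        · have := uN_nonneg N 1 α
          simp only [if_true, if_neg h0o.symm]
          simp only [o]
          linarith
        · simpa only [if_neg hj0, if_neg hjo, add_zero] using this
  rw [hl]
  refine (Finset.sum_le_sum fun j _ => hle j).trans_eq ?_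
  rw [Finset.sum_add_distrib, Finset.sum_add_distrib, ← Finset.mul_sum, sum_coin,
    Finset.sum_ite_eq' , Finset.sum_ite_eq', if_pos (Finset.mem_univ _),
    if_pos (Finset.mem_univ _), beta_eq]
  ring

end Hellinger

/-! ### The critical weight -/

section Critical

variable {N : ℕ} {α lam : ℝ}

lemma isGreatest_alphaN (hl : lam ∈ Set.Icc (0 : ℝ) 1) :
    IsGreatest (compatWeights N lam) (alphaN N lam) := by
  have hc : IsCompact (compatWeights N lam) := by
    have := ((isCompact_splits N).inter_right
      (isClosed_singleton.preimage continuous_snd : IsClosed (Prod.snd ⁻¹' {lam}))).image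
      continuous_fst
    convert this using 1
    ext a
    simp only [mem_compatWeights_iff, Set.mem_image, Set.mem_inter_iff, Set.mem_ofPred_eq,
      Set.mem_preimage, Set.mem_singleton_iff, Prod.exists]
    constructor
    · rintro ⟨ha, hs⟩
      exact ⟨a, lam, ⟨⟨ha, hl, hs⟩, rfl⟩, rfl⟩
    · rintro ⟨x, y, ⟨⟨ha, -, hs⟩, rfl⟩, rfl⟩
      exact ⟨ha, hs⟩
  exact hc.isGreatest_sSup
    ⟨0, mem_compatWeights_iff.2 ⟨⟨le_rfl, zero_le_one⟩, splits_zero_left hl.1 hl.2⟩⟩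

lemma alphaN_mem (hl : lam ∈ Set.Icc (0 : ℝ) 1) : alphaN N lam ∈ Set.Icc (0 : ℝ) 1 :=
  (mem_compatWeights_iff.1 (isGreatest_alphaN hl).1).1

lemma splits_alphaN (hl : lam ∈ Set.Icc (0 : ℝ) 1) : Splits N (alphaN N lam) lam :=
  (mem_compatWeights_iff.1 (isGreatest_alphaN hl).1).2

lemma Splits.le_alphaN (h : Splits N α lam) (hα : α ∈ Set.Icc (0 : ℝ) 1)
    (hl : lam ∈ Set.Icc (0 : ℝ) 1) : α ≤ alphaN N lam :=
  (isGreatest_alphaN hl).2 (mem_compatWeights_iff.2 ⟨hα, h⟩)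

/-- Lowering `lam` allows the weight `(1 - t) * α + t`, which is larger than `α` unless `α = 1`; for
positive `lam` the Hellinger bound excludes `α = 1`. -/
lemma strictAntiOn_alphaN (hN : 1 ≤ N) : StrictAntiOn (alphaN N) (Set.Icc 0 1) := by
  intro a ha b hb hab
  obtain ⟨t, ht0, ht1, hs⟩ := (splits_alphaN hb).exists_larger_weight (N := N) ha.1 hab
  have hmem := alphaN_mem (N := N) hb
  have hne : alphaN N b ≠ 1 := fun h => by
    have := (splits_alphaN hb).le_beta hN hmem
    rw [h, beta_one] at this
    linarith [ha.1]
  have hlt : alphaN N b < 1 := lt_of_le_of_ne hmem.2 hne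
  have hle := hs.le_alphaN ⟨by nlinarith [hmem.1], by nlinarith [hmem.1]⟩ ha
  nlinarith

lemma bijOn_alphaN (hN : 1 ≤ N) : Set.BijOn (alphaN N) (Set.Icc 0 1) (Set.Icc 0 1) := by
  refine ⟨fun a ha => alphaN_mem ha, (strictAntiOn_alphaN hN).injOn, fun α hα => ?_⟩
  have hc : IsCompact {lam | lam ∈ Set.Icc (0 : ℝ) 1 ∧ Splits N α lam} := by
    have := ((isCompact_splits N).inter_right
      (isClosed_singleton.preimage continuous_fst : IsClosed (Prod.fst ⁻¹' {α}))).image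
      continuous_snd
    convert this using 1
    ext a
    simp only [Set.mem_image, Set.mem_inter_iff, Set.mem_ofPred_eq,
      Set.mem_preimage, Set.mem_singleton_iff, Prod.exists]
    constructor
    · rintro ⟨ha, hs⟩
      exact ⟨α, a, ⟨⟨hα, ha, hs⟩, rfl⟩, rfl⟩
    · rintro ⟨x, y, ⟨⟨-, ha, hs⟩, rfl⟩, rfl⟩
      exact ⟨ha, hs⟩
  obtain ⟨m, ⟨hm, hms⟩, hmax⟩ := hc.exists_isGreatest
    ⟨0, ⟨le_rfl, zero_le_one⟩, splits_zero_right hα.1 hα.2⟩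
  refine ⟨m, hm, ((hms.le_alphaN hα hm).antisymm ?_).symm⟩
  by_contra! hlt
  have hm1 : m < 1 := by
    refine lt_of_le_of_ne hm.2 fun h => ?_
    have h1 := (splits_alphaN hm).le_beta hN (alphaN_mem hm)
    have h2 := (strictAntiOn_beta hN) ⟨le_rfl, zero_le_one⟩ (alphaN_mem hm) (hα.1.trans_lt hlt)
    rw [beta_zero] at h2
    linarith
  have hpos : 0 < alphaN N m := hα.1.trans_lt hlt
  -- If the weight `α` were not critical at the maximal `m`, the unused weight could be spent on
  -- exceeding `m`.
  obtain ⟨m', hmm, hm'1, hs⟩ := (splits_alphaN hm).exists_larger_right (t := α / alphaN N m)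
    hm.1 hm1 (div_nonneg hα.1 hpos.le) ((div_lt_one hpos).2 hlt)
  rw [div_mul_cancel₀ _ hpos.ne'] at hs
  exact absurd (hmax ⟨⟨hm.1.trans hmm.le, hm'1⟩, hs⟩) (not_le.2 hmm)

lemma unitInv_mem {f : ℝ → ℝ} (hf : Set.BijOn f (Set.Icc 0 1) (Set.Icc 0 1))
    (hα : α ∈ Set.Icc (0 : ℝ) 1) : unitInv f α ∈ Set.Icc (0 : ℝ) 1 :=
  Function.invFunOn_mem (hf.surjOn hα)

lemma apply_unitInv {f : ℝ → ℝ} (hf : Set.BijOn f (Set.Icc 0 1) (Set.Icc 0 1))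
    (hα : α ∈ Set.Icc (0 : ℝ) 1) : f (unitInv f α) = α :=
  Function.invFunOn_eq (hf.surjOn hα)

lemma bijOn_unitInv {f : ℝ → ℝ} (hf : Set.BijOn f (Set.Icc 0 1) (Set.Icc 0 1)) :
    Set.BijOn (unitInv f) (Set.Icc 0 1) (Set.Icc 0 1) :=
  hf.symm hf.invOn_invFunOn.symm

/-- Applied to `beta`, this identifies the inverse of `upperN` with `beta` itself on `[0, 1]`. -/
lemma unitInv_unitInv {f : ℝ → ℝ} (hf : Set.BijOn f (Set.Icc 0 1) (Set.Icc 0 1))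
    (hα : α ∈ Set.Icc (0 : ℝ) 1) : unitInv (unitInv f) α = f α := by
  have h1 := unitInv_mem (bijOn_unitInv hf) hα
  rw [← apply_unitInv hf h1 , apply_unitInv (bijOn_unitInv hf) hα]

lemma splits_unitInv (hN : 1 ≤ N) (hα : α ∈ Set.Icc (0 : ℝ) 1) :
    Splits N α (unitInv (alphaN N) α) := by
  have := splits_alphaN (N := N) (unitInv_mem (bijOn_alphaN hN) hα)
  rwa [apply_unitInv (bijOn_alphaN hN) hα] at this

lemma Splits.le_unitInv (h : Splits N α lam) (hN : 1 ≤ N) (hα : α ∈ Set.Icc (0 : ℝ) 1)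
    (hl : lam ∈ Set.Icc (0 : ℝ) 1) : lam ≤ unitInv (alphaN N) α := by
  have h1 := h.le_alphaN hα hl
  rw [← apply_unitInv (bijOn_alphaN hN) hα] at h1
  exact ((strictAntiOn_alphaN hN).le_iff_ge (unitInv_mem (bijOn_alphaN hN) hα) hl).1 h1

end Critical

/-! ### Splittings for few levels -/

section FewLevels

variable {α lam : ℝ}

lemma splits_of_offDiag {N : ℕ} {C : Fin (N + 1) → Matrix (Fin (N + 1)) (Fin (N + 1)) ℝ}
    (hC : ∀ j, (C j).PosSemidef) (hd : ∀ j k, C j k k = mixProb N α j k)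
    (ho : ∀ k l, k < l → ∑ j, C j k l = gauss N lam k l) : Splits N α lam := by
  refine ⟨C, hC, ?_, hd⟩
  ext k l
  rw [Matrix.sum_apply]
  rcases lt_trichotomy k l with h | rfl | h
  · exact ho k l h
  · simp [hd, sum_mixProb]
  · rw [gauss_symm, ← ho l k h]
    exact Finset.sum_congr rfl fun j _ => (hC j).symm_apply k l

/-- With two levels only one off-diagonal entry must be matched, and rank-one parts attain equality
in its `2 × 2` minors. -/
lemma splits_one_level (hα : α ∈ Set.Icc (0 : ℝ) 1) :
    Splits 1 α (uN 1 0 α + uN 1 1 α) := by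
  have hp := fun j k : Fin 2 => mixProb_nonneg (N := 1) hα.1 hα.2 j k
  refine splits_of_offDiag (C := fun j => Matrix.vecMulVec (fun k => √(mixProb 1 α j k))
    (star fun k => √(mixProb 1 α j k)))
    (fun j => Matrix.posSemidef_vecMulVec_self_star _) (fun j k => ?_) (fun k l hkl => ?_)
  · simp [Matrix.vecMulVec_apply, Real.mul_self_sqrt (hp j k)]
  · obtain ⟨rfl, rfl⟩ : k = 0 ∧ l = 1 :=
      (by decide : ∀ k l : Fin 2, k < l → k = 0 ∧ l = 1) k l hkl
    simp only [Matrix.vecMulVec_apply, star_trivial,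
      ← Real.sqrt_mul (hp _ _), gauss_apply, uN]
    simp [mixProb]
    ring_nf

/-- The form of the correlation matrix with entries `a`, `b`, `a * b`, rescaled by `s`, `t`, `t`:
the last two variables are correlated only through the first. -/
lemma quad_center_nonneg {s t a b : ℝ} (ha : a ^ 2 ≤ 1) (hb : b ^ 2 ≤ 1) (x y z : ℝ) :
    0 ≤ (s * x + t * (a * y + b * z)) ^ 2 +
      t ^ 2 * ((1 - a ^ 2) * y ^ 2 + (1 - b ^ 2) * z ^ 2) :=
  add_nonneg (sq_nonneg _) (mul_nonneg (sq_nonneg _) (add_nonneg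
    (mul_nonneg (by linarith) (sq_nonneg _)) (mul_nonneg (by linarith) (sq_nonneg _))))

lemma coin_two : coin 2 0 = 1 / 4 ∧ coin 2 1 = 1 / 2 ∧ coin 2 2 = 1 / 4 := by
  norm_num [coin, Nat.choose]

/-- Outcome `1` has rank one, outcome `0` has correlations `a, b, a * b` centred at its own level,
and outcome `2` is the mirror image. The last two hypotheses match the entries at distances `1` and
`2`. -/
lemma splits_two_levels_aux {s₀ t₀ s₁ t₁ a b : ℝ} (hs₀ : s₀ ^ 2 = α + (1 - α) / 4)
    (ht₀ : t₀ ^ 2 = (1 - α) / 4) (hs₁ : s₁ ^ 2 = α + (1 - α) / 2) (ht₁ : t₁ ^ 2 = (1 - α) / 2)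
    (ha : a ^ 2 ≤ 1) (hb : b ^ 2 ≤ 1) (h1 : s₀ * t₀ * a + s₁ * t₁ + t₀ ^ 2 * a * b = lam)
    (h2 : 2 * (s₀ * t₀ * b) + t₁ ^ 2 = lam ^ 4) : Splits 2 α lam := by
  have hd : ∀ j k, (![!![s₀ ^ 2, s₀ * t₀ * a, s₀ * t₀ * b;
      s₀ * t₀ * a, t₀ ^ 2, t₀ ^ 2 * a * b; s₀ * t₀ * b, t₀ ^ 2 * a * b, t₀ ^ 2],
      !![t₁ ^ 2, s₁ * t₁, t₁ ^ 2; s₁ * t₁, s₁ ^ 2, s₁ * t₁; t₁ ^ 2, s₁ * t₁, t₁ ^ 2],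
      !![t₀ ^ 2, t₀ ^ 2 * a * b, s₀ * t₀ * b; t₀ ^ 2 * a * b, t₀ ^ 2, s₀ * t₀ * a;
      s₀ * t₀ * b, s₀ * t₀ * a, s₀ ^ 2]] :
      Fin 3 → Matrix (Fin 3) (Fin 3) ℝ) j k k = mixProb 2 α j k := fun j k => by
    obtain ⟨c0, c1, c2⟩ := coin_two
    fin_cases j <;> fin_cases k <;> simp [mixProb, c0, c1, c2, hs₀, ht₀, hs₁, ht₁] <;> ring
  refine splits_of_offDiag (fun j => ?_) hd fun k l hkl => ?_
  · refine posSemidef_of_symm_of_nonneg (fun k l => ?_) fun x => ?_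
    · fin_cases j <;> fin_cases k <;> fin_cases l <;> rfl
    · fin_cases j
      · refine (quad_center_nonneg (s := s₀) (t := t₀) ha hb (x 0) (x 1) (x 2)).trans_eq ?_
        simp [Fin.sum_univ_three]
        ring
      · refine (sq_nonneg (t₁ * x 0 + s₁ * x 1 + t₁ * x 2)).trans_eq ?_
        simp [Fin.sum_univ_three]
        ring
      · refine (quad_center_nonneg (s := s₀) (t := t₀) ha hb (x 2) (x 1) (x 0)).trans_eq ?_
        simp [Fin.sum_univ_three]
        ring
  · obtain ⟨rfl, rfl⟩ | ⟨rfl, rfl⟩ | ⟨rfl, rfl⟩ :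
        (k = 0 ∧ l = 1) ∨ (k = 0 ∧ l = 2) ∨ (k = 1 ∧ l = 2) :=
      (by decide : ∀ k l : Fin 3, k < l →
        (k = 0 ∧ l = 1) ∨ (k = 0 ∧ l = 2) ∨ (k = 1 ∧ l = 2)) k l hkl
    · simp [Fin.sum_univ_three, gauss_apply]
      linarith
    · simp [Fin.sum_univ_three, gauss_apply]
      linarith
    · simp [Fin.sum_univ_three, gauss_apply]
      linarith

/-- For two qubits a slightly smaller `lam` than `u₀ + u₁` is reached. -/
lemma splits_two_levels (h0 : 0 < α) (h1 : α < 1) :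
    Splits 2 α (uN 2 0 α + uN 2 1 α - (1 - α) ^ 2 / (16 * uN 2 0 α)) ∧
      uN 2 0 α + uN 2 1 α - (1 - α) ^ 2 / (16 * uN 2 0 α) ∈ Set.Icc (0 : ℝ) 1 := by
  obtain ⟨c0, c1, -⟩ := coin_two
  have hα : α ∈ Set.Icc (0 : ℝ) 1 := ⟨h0.le, h1.le⟩
  have he := sub_pos.2 h1
  have hu0 := uN_sq hα 2 0
  have hu1 := uN_sq hα 2 1
  have hu0e := uN_eq_mul hα 2 0
  have hu1e := uN_eq_mul hα 2 1
  have hsum := (uN_add_uN_mem (by norm_num : 1 ≤ 2) hα).2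
  have hn0 := uN_nonneg 2 0 α
  have hn1 := uN_nonneg 2 1 α
  rw [c0] at hu0 hu0e
  rw [c1] at hu1 hu1e
  set u₀ := uN 2 0 α
  set u₁ := uN 2 1 α
  set q := (1 - α) / 4 with hq
  have hq0 : 0 < q := by positivity
  have hu0' : u₀ ^ 2 = q * (α + q) := by rw [hu0, hq]; ring
  have hu1' : u₁ ^ 2 = 2 * q * (α + 2 * q) := by rw [hu1, hq]; ring
  have hαq : α = 1 - 4 * q := by rw [hq]; ring
  have hpos : 0 < u₀ := by
    refine hn0.lt_of_ne fun h => ?_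
    rw [← h] at hu0'
    have := mul_pos hq0 (add_pos h0 hq0)
    linarith
  have hd : (1 - α) ^ 2 / (16 * u₀) = q ^ 2 / u₀ := by
    rw [hq]; field_simp; ring
  rw [hd]
  have hqu : q ≤ u₀ :=
    (abs_le_of_sq_le_sq' (by rw [hu0']; nlinarith only [mul_pos hq0 h0]) hn0).2
  have hdiv : q ^ 2 / u₀ < u₀ := by
    rw [div_lt_iff₀ hpos, ← pow_two, hu0']; nlinarith only [mul_pos hq0 h0]
  have hdiv0 : 0 ≤ q ^ 2 / u₀ := by positivity
  have hu1b : u₁ ≤ 1 / 2 := by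
    refine abs_le_of_sq_le_sq' ?_ (by norm_num) |>.2
    rw [hu1']
    linear_combination (1 / 4) * sq_nonneg (1 - 4 * q) + (2 * q) * hαq
  have hu0b : u₀ ≤ 3 / 10 := by
    refine abs_le_of_sq_le_sq' ?_ (by norm_num) |>.2
    rw [hu0']
    linear_combination (1 / 12) * sq_nonneg (1 - 6 * q) + q * hαq
  have hu12 : u₁ ≤ 2 * u₀ := by
    refine abs_le_of_sq_le_sq' ?_ (by positivity) |>.2
    rw [mul_pow, hu1', hu0']
    nlinarith only [mul_pos hq0 h0]
  set lam := u₀ + u₁ - q ^ 2 / u₀ with hlam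
  have hl0 : 0 ≤ lam := by linarith
  have hl1 : lam ≤ 1 := by linarith
  refine ⟨?_, hl0, hl1⟩
  have hl8 : lam ≤ 8 / 10 := by linarith
  have hl4 : lam ^ 4 ≤ 2 * u₀ := by
    have h3 : lam ^ 3 ≤ (8 / 10) ^ 3 := by gcongr
    calc lam ^ 4 = lam ^ 3 * lam := by ring
      _ ≤ (8 / 10) ^ 3 * (3 * u₀) := by
          gcongr
          linarith
      _ ≤ 2 * u₀ := by linarith
  -- `b` solves the equation at distance `2`, and `|b| ≤ 1` follows from `lam ^ 4 ≤ 2 * u₀` and `q ≤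
  -- u₀`.
  set b := (lam ^ 4 - 2 * q) / (2 * u₀) with hb
  have hbmul : 2 * u₀ * b = lam ^ 4 - 2 * q := by rw [hb]; field_simp
  have hl4n : 0 ≤ lam ^ 4 := by positivity
  have hb1 : b ≤ 1 := by
    rw [hb, div_le_one (by positivity)]; linarith
  have hb2 : -1 ≤ b := by
    rw [hb, le_div_iff₀ (by positivity)]; linarith
  have hbq : u₀ - q ^ 2 / u₀ ≤ u₀ + q * b := by
    have : -(q ^ 2 / u₀) = q * (-(2 * q) / (2 * u₀)) := by field_simp
    rw [sub_eq_add_neg, this, hb]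
    gcongr
    linarith
  have hden : 0 < u₀ + q * b := by linarith
  -- `a` solves the equation at distance `1`. Since `b ≥ -q / u₀`, the denominator is at least `u₀ -
  -- q ^ 2 / u₀`; subtracting `q ^ 2 / u₀` from `lam` is what guarantees `a ≤ 1`.
  set a := (u₀ - q ^ 2 / u₀) / (u₀ + q * b) with ha
  have hamul : a * (u₀ + q * b) = u₀ - q ^ 2 / u₀ := by rw [ha]; field_simp
  have ha0 : 0 ≤ a := div_nonneg (by linarith) hden.le
  have ha1 : a ≤ 1 := (div_le_one hden).2 hbq
  have hs0 : 0 ≤ 1 / 4 * (1 - α) := by positivity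
  have hs1 : 0 ≤ 1 / 2 * (1 - α) := by positivity
  refine splits_two_levels_aux (s₀ := √(α + 1 / 4 * (1 - α))) (t₀ := √(1 / 4 * (1 - α)))
    (s₁ := √(α + 1 / 2 * (1 - α))) (t₁ := √(1 / 2 * (1 - α))) (a := a) (b := b) ?_ ?_ ?_ ?_
    (by rw [sq_le_one_iff_abs_le_one, abs_le]; exact ⟨by linarith, ha1⟩)
    (by rw [sq_le_one_iff_abs_le_one, abs_le]; exact ⟨hb2, hb1⟩) ?_ ?_
  · rw [Real.sq_sqrt (by positivity)]; ring
  · rw [Real.sq_sqrt (by positivity)]; ring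
  · rw [Real.sq_sqrt (by positivity)]; ring
  · rw [Real.sq_sqrt (by positivity)]; ring
  · rw [mul_comm √(α + 1 / 4 * (1 - α)), mul_comm √(α + 1 / 2 * (1 - α)), ← hu0e, ← hu1e,
      Real.sq_sqrt hs0, hlam]
    linear_combination hamul + (a * b) * (by rw [hq]; ring : 1 / 4 * (1 - α) = q)
  · rw [mul_comm √(α + 1 / 4 * (1 - α)), ← hu0e, Real.sq_sqrt hs1]
    linear_combination hbmul + (by rw [hq]; ring : 1 / 2 * (1 - α) = 2 * q)

lemma coin_three : coin 3 0 = 1 / 8 ∧ coin 3 1 = 3 / 8 ∧ coin 3 2 = 3 / 8 ∧ coin 3 3 = 1 / 8 := by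
  norm_num [coin, Nat.choose]

lemma quad_pair_nonneg {a b q : ℝ} (h : a ^ 2 + b ^ 2 ≤ q) (z e f : ℝ) :
    0 ≤ z ^ 2 + 2 * z * (a * e + b * f) + q * (e ^ 2 + f ^ 2) := by
  have h1 := sq_nonneg (z + a * e + b * f)
  have h2 := sq_nonneg (a * f - b * e)
  have h3 := mul_nonneg (sub_nonneg.2 h) (add_nonneg (sq_nonneg e) (sq_nonneg f))
  nlinarith

/-- Outcomes `0` and `1` have rank one on the levels `{0, 1}`, giving the entry `u₀ + u₁` there.
This vector is coupled by `d` to level `3` for outcome `0`, and by `a`, `b` to levels `2`, `3` for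
outcome `1`. The other two outcomes are mirror images, so four entries remain to be matched. -/
lemma splits_three_levels_aux {s₀ t₀ s₁ t₁ a b d : ℝ} (hs₀ : s₀ ^ 2 = α + (1 - α) / 8)
    (ht₀ : t₀ ^ 2 = (1 - α) / 8) (hs₁ : s₁ ^ 2 = α + 3 * (1 - α) / 8)
    (ht₁ : t₁ ^ 2 = 3 * (1 - α) / 8) (hab : a ^ 2 + b ^ 2 ≤ t₁ ^ 2) (hdt : d ^ 2 ≤ t₀ ^ 2)
    (h01 : s₀ * t₀ + s₁ * t₁ = lam) (h12 : 2 * (s₁ * a) = lam)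
    (h02 : t₁ * a + s₁ * b + t₀ * d = lam ^ 4) (h03 : 2 * (s₀ * d) + 2 * (t₁ * b) = lam ^ 9) :
    Splits 3 α lam := by
  have hd : ∀ j k, (![
      !![s₀ ^ 2, s₀ * t₀, 0, s₀ * d; s₀ * t₀, t₀ ^ 2, 0, t₀ * d;
        0, 0, t₀ ^ 2, 0; s₀ * d, t₀ * d, 0, t₀ ^ 2],
      !![t₁ ^ 2, s₁ * t₁, t₁ * a, t₁ * b; s₁ * t₁, s₁ ^ 2, s₁ * a, s₁ * b;
        t₁ * a, s₁ * a, t₁ ^ 2, 0; t₁ * b, s₁ * b, 0, t₁ ^ 2],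
      !![t₁ ^ 2, 0, s₁ * b, t₁ * b; 0, t₁ ^ 2, s₁ * a, t₁ * a;
        s₁ * b, s₁ * a, s₁ ^ 2, s₁ * t₁; t₁ * b, t₁ * a, s₁ * t₁, t₁ ^ 2],
      !![t₀ ^ 2, 0, t₀ * d, s₀ * d; 0, t₀ ^ 2, 0, 0;
        t₀ * d, 0, t₀ ^ 2, s₀ * t₀; s₀ * d, 0, s₀ * t₀, s₀ ^ 2]] :
      Fin 4 → Matrix (Fin 4) (Fin 4) ℝ) j k k = mixProb 3 α j k := fun j k => by
    obtain ⟨c0, c1, c2, c3⟩ := coin_three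
    fin_cases j <;> fin_cases k <;> simp [mixProb, c0, c1, c2, c3, hs₀, ht₀, hs₁, ht₁] <;> ring
  have hd0 : (0 : ℝ) ^ 2 + d ^ 2 ≤ t₀ ^ 2 := by linarith
  refine splits_of_offDiag (fun j => ?_) hd fun k l hkl => ?_
  · refine posSemidef_of_symm_of_nonneg (fun k l => ?_) fun x => ?_
    · fin_cases j <;> fin_cases k <;> fin_cases l <;> rfl
    · fin_cases j
      · refine (quad_pair_nonneg hd0 (s₀ * x 0 + t₀ * x 1) (x 2) (x 3)).trans_eq ?_
        simp [Fin.sum_univ_four]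
        ring
      · refine (quad_pair_nonneg hab (s₁ * x 1 + t₁ * x 0) (x 2) (x 3)).trans_eq ?_
        simp [Fin.sum_univ_four]
        ring
      · refine (quad_pair_nonneg hab (s₁ * x 2 + t₁ * x 3) (x 1) (x 0)).trans_eq ?_
        simp [Fin.sum_univ_four]
        ring
      · refine (quad_pair_nonneg hd0 (s₀ * x 3 + t₀ * x 2) (x 1) (x 0)).trans_eq ?_
        simp [Fin.sum_univ_four]
        ring
  · obtain ⟨rfl, rfl⟩ | ⟨rfl, rfl⟩ | ⟨rfl, rfl⟩ | ⟨rfl, rfl⟩ | ⟨rfl, rfl⟩ | ⟨rfl, rfl⟩ :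
        (k = 0 ∧ l = 1) ∨ (k = 0 ∧ l = 2) ∨ (k = 1 ∧ l = 2) ∨ (k = 0 ∧ l = 3) ∨
        (k = 1 ∧ l = 3) ∨ (k = 2 ∧ l = 3) :=
      (by decide : ∀ k l : Fin 4, k < l →
        (k = 0 ∧ l = 1) ∨ (k = 0 ∧ l = 2) ∨ (k = 1 ∧ l = 2) ∨ (k = 0 ∧ l = 3) ∨
        (k = 1 ∧ l = 3) ∨ (k = 2 ∧ l = 3)) k l hkl
    all_goals
      simp [Fin.sum_univ_four, gauss_apply]
      linarith

end FewLevels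

/-! ### Solving the three-qubit equations and estimating the solution -/

section ThreeQubits

variable {α lam : ℝ}

/-- Here `a = m * t₁` and `b = y * t₁`. The entry `(0, 3)` expresses `d` through `y`, using `t₁ ^ 2
= 3 * t₀ ^ 2`; inserting this into the entry `(0, 2)` gives the linear equation `hy`. -/
lemma splits_three_levels_of_ratios {s₀ t₀ s₁ t₁ m y : ℝ} (hs₀ : s₀ ^ 2 = α + (1 - α) / 8)
    (ht₀ : t₀ ^ 2 = (1 - α) / 8) (hs₁ : s₁ ^ 2 = α + 3 * (1 - α) / 8)
    (ht₁ : t₁ ^ 2 = 3 * (1 - α) / 8) (hs₀' : 0 < s₀) (ht₀' : 0 < t₀) (hs₁' : 0 < s₁)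
    (hlam : lam = s₀ * t₀ + s₁ * t₁) (hm : 2 * (s₁ * t₁) * m = lam)
    (hy : y * (1 - t₀ / s₀ * (t₁ / s₁)) =
      m * (2 * lam ^ 3 - t₁ / s₁ - t₀ / s₀ * lam ^ 8))
    (hmy : m ^ 2 + y ^ 2 ≤ 1) (hx : |lam / (2 * (s₀ * t₀)) * lam ^ 8 - 3 * (t₀ / s₀) * y| ≤ 1) :
    Splits 3 α lam := by
  have e13 : t₁ ^ 2 = 3 * t₀ ^ 2 := by rw [ht₁, ht₀]; ring
  refine splits_three_levels_aux hs₀ ht₀ hs₁ ht₁ (a := m * t₁) (b := y * t₁)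
    (d := (lam / (2 * (s₀ * t₀)) * lam ^ 8 - 3 * (t₀ / s₀) * y) * t₀) ?_ ?_ hlam.symm ?_ ?_ ?_
  · calc (m * t₁) ^ 2 + (y * t₁) ^ 2 = (m ^ 2 + y ^ 2) * t₁ ^ 2 := by ring
      _ ≤ 1 * t₁ ^ 2 := by gcongr
      _ = t₁ ^ 2 := one_mul _
  · rw [mul_pow]
    have := (sq_le_one_iff_abs_le_one _).2 hx
    exact mul_le_of_le_one_left (sq_nonneg _) this
  · rw [← hm]; ring
  · have k1 : t₁ * (m * t₁) = t₁ / s₁ * lam / 2 := by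
      rw [← hm]; field_simp
    have k2 : (lam / (2 * (s₀ * t₀)) * lam ^ 8) * t₀ * t₀ = t₀ / s₀ * lam ^ 9 / 2 := by
      field_simp
    have k3 : 3 * (t₀ / s₀) * y * t₀ * t₀ = t₀ / s₀ * (t₁ / s₁) * y * (s₁ * t₁) := by
      field_simp
      linear_combination (-y) * e13
    linear_combination k1 + k2 - k3 + s₁ * t₁ * hy +
      (lam ^ 3 - (t₁ / s₁) / 2 - t₀ / s₀ * lam ^ 8 / 2) * hm
  · field_simp
    linear_combination (2 * y) * e13

/-- The bound for three qubits at weights close to `1`. -/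
lemma splits_three_levels_of_le (h0 : 3 / 10 ≤ α) (h1 : α < 1) :
    Splits 3 α (uN 3 0 α + uN 3 1 α) := by
  obtain ⟨c0, c1, -, -⟩ := coin_three
  have hα : α ∈ Set.Icc (0 : ℝ) 1 := ⟨by linarith, h1.le⟩
  have hu0e := uN_eq_mul hα 3 0
  have hu1e := uN_eq_mul hα 3 1
  rw [c0, mul_comm] at hu0e
  rw [c1, mul_comm] at hu1e
  have he : 0 < 1 - α := sub_pos.2 h1
  have hs₀ : √(α + 1 / 8 * (1 - α)) ^ 2 = α + (1 - α) / 8 := by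
    rw [Real.sq_sqrt (by linarith)]; ring
  have ht₀ : √(1 / 8 * (1 - α)) ^ 2 = (1 - α) / 8 := by
    rw [Real.sq_sqrt (by linarith)]; ring
  have hs₁ : √(α + 3 / 8 * (1 - α)) ^ 2 = α + 3 * (1 - α) / 8 := by
    rw [Real.sq_sqrt (by linarith)]; ring
  have ht₁ : √(3 / 8 * (1 - α)) ^ 2 = 3 * (1 - α) / 8 := by
    rw [Real.sq_sqrt (by linarith)]; ring
  have hs₀' : 0 < √(α + 1 / 8 * (1 - α)) := Real.sqrt_pos.2 (by linarith)
  have ht₀' : 0 < √(1 / 8 * (1 - α)) := Real.sqrt_pos.2 (by linarith)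
  have hs₁' : 0 < √(α + 3 / 8 * (1 - α)) := Real.sqrt_pos.2 (by linarith)
  have ht₁' : 0 < √(3 / 8 * (1 - α)) := Real.sqrt_pos.2 (by linarith)
  rw [hu0e, hu1e]
  clear hu0e hu1e
  generalize √(α + 1 / 8 * (1 - α)) = s₀ at *
  generalize √(1 / 8 * (1 - α)) = t₀ at *
  generalize √(α + 3 / 8 * (1 - α)) = s₁ at *
  generalize √(3 / 8 * (1 - α)) = t₁ at *
  obtain ⟨e, rfl⟩ : ∃ e, α = 1 - e := ⟨1 - α, by ring⟩
  have hu0 : (s₀ * t₀) ^ 2 = e / 8 * (1 - 7 * e / 8) := by rw [mul_pow, hs₀, ht₀]; ring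
  have hu1 : (s₁ * t₁) ^ 2 = 3 * e / 8 * (1 - 5 * e / 8) := by rw [mul_pow, hs₁, ht₁]; ring
  have hu0' : 0 < s₀ * t₀ := by positivity
  have hu1' : 0 < s₁ * t₁ := by positivity
  have he0 : 0 < e := by linarith
  have he7 : e ≤ 7 / 10 := by linarith
  have hu0u : s₀ * t₀ ≤ 19 / 100 := by
    refine (abs_le_of_sq_le_sq' ?_ (by norm_num)).2
    rw [hu0]; nlinarith only [sq_nonneg (7 * e - 4)]
  have hu1u : s₁ * t₁ ≤ 39 / 100 := by
    refine (abs_le_of_sq_le_sq' ?_ (by norm_num)).2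
    rw [hu1]; nlinarith only [sq_nonneg (5 * e - 4)]
  -- Rounded up from `1 / √3`, the limit of `u₀ / u₁` as `e → 0`. The constants of `hr2`, `hτ1` and
  -- `hσ1` are rounded values at the other end, `e = 7 / 10`.
  have hr1 : s₀ * t₀ ≤ 5776 / 10000 * (s₁ * t₁) := by
    refine (abs_le_of_sq_le_sq' ?_ (by positivity)).2
    rw [mul_pow (5776 / 10000), hu0, hu1]; nlinarith only [he0]
  have hr2 : s₁ * t₁ ≤ 21 / 10 * (s₀ * t₀) := by
    refine (abs_le_of_sq_le_sq' ?_ (by positivity)).2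
    rw [mul_pow (21 / 10), hu0, hu1]; nlinarith only [he0, he7]
  have hτσ : ∀ a b : ℝ, 0 ≤ a → 0 ≤ b → t₀ ^ 2 ≤ (a * s₀) ^ 2 → t₁ ^ 2 ≤ (b * s₁) ^ 2 →
      t₀ / s₀ ≤ a ∧ t₁ / s₁ ≤ b := fun a b ha hb h h' =>
    ⟨(div_le_iff₀ hs₀').2 (abs_le_of_sq_le_sq' h (by positivity)).2,
      (div_le_iff₀ hs₁').2 (abs_le_of_sq_le_sq' h' (by positivity)).2⟩
  have hτ0 : 0 < t₀ / s₀ := by positivity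
  have hσ0 : 0 < t₁ / s₁ := by positivity
  obtain ⟨hτ1, hσ1⟩ : t₀ / s₀ ≤ 4753 / 10000 ∧ t₁ / s₁ ≤ 6832 / 10000 := by
    refine hτσ _ _ (by norm_num) (by norm_num) ?_ ?_
    · rw [mul_pow, ht₀, hs₀]; linarith
    · rw [mul_pow, ht₁, hs₁]; linarith
  -- For `e ≤ 1 / 2` the ratios are small enough that `2 * lam ^ 3` can be dropped in the lower
  -- bound for `y`. For `e ≥ 1 / 2` that term is kept, with `lam ≥ 45 / 100` and a better bound on
  -- `m`.
  have hcases : (t₀ / s₀ ≤ 3334 / 10000 ∧ t₁ / s₁ ≤ 5223 / 10000) ∨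
      (s₀ * t₀ ≤ 5224 / 10000 * (s₁ * t₁) ∧ 45 / 100 ≤ s₀ * t₀ + s₁ * t₁) := by
    rcases le_total e (1 / 2) with h | h
    · left
      refine hτσ _ _ (by norm_num) (by norm_num) ?_ ?_
      · rw [mul_pow, ht₀, hs₀]; linarith
      · rw [mul_pow, ht₁, hs₁]; linarith
    · right
      constructor
      · refine (abs_le_of_sq_le_sq' ?_ (by positivity)).2
        rw [mul_pow (5224 / 10000), hu0, hu1]; nlinarith only [h, he0]
      · have l0 : 1 / 10 ≤ s₀ * t₀ := by
          refine (abs_le_of_sq_le_sq' ?_ hu0'.le).2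
          rw [hu0]; nlinarith only [h, he7]
        have l1 : 35 / 100 ≤ s₁ * t₁ := by
          refine (abs_le_of_sq_le_sq' ?_ hu1'.le).2
          rw [hu1]; nlinarith only [h, he7]
        linarith
  obtain ⟨lam, hlam⟩ : ∃ lam, lam = s₀ * t₀ + s₁ * t₁ := ⟨_, rfl⟩
  obtain ⟨m, hm⟩ : ∃ m, 2 * (s₁ * t₁) * m = lam := ⟨lam / (2 * (s₁ * t₁)), by field_simp⟩
  have hm0 : 0 < m := by
    have : 0 < 2 * (s₁ * t₁) * m := by rw [hm, hlam]; positivity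
    exact (mul_pos_iff_of_pos_left (by positivity)).1 this
  have hmle : ∀ r : ℝ, s₀ * t₀ ≤ r * (s₁ * t₁) → m ≤ (1 + r) / 2 := fun r hr => by
    have : 2 * (s₁ * t₁) * m ≤ 2 * (s₁ * t₁) * ((1 + r) / 2) := by rw [hm, hlam]; linarith
    exact le_of_mul_le_mul_left this (by positivity)
  have hm1 := hmle _ hr1
  have hl0 : 0 < lam := by rw [hlam]; positivity
  have hl6 : lam ≤ 6 / 10 := by rw [hlam]; linarith
  have hl3 : lam ^ 3 ≤ (6 / 10) ^ 3 := by gcongr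
  have hl8 : lam ^ 8 ≤ (6 / 10) ^ 8 := by gcongr
  have hl8' : 0 < lam ^ 8 := by positivity
  have hl3' : 0 < lam ^ 3 := by positivity
  have hprod : t₀ / s₀ * (t₁ / s₁) ≤ 4753 / 10000 * (6832 / 10000) := by gcongr
  have hden : 0 < 1 - t₀ / s₀ * (t₁ / s₁) := by linarith
  have hxl : lam / (2 * (s₀ * t₀)) ≤ 155 / 100 := by
    rw [div_le_iff₀ (by positivity), hlam]; linarith
  have hxl0 : 0 < lam / (2 * (s₀ * t₀)) := by positivity
  have hτl : t₀ / s₀ * lam ^ 8 ≤ 4753 / 10000 * (6 / 10) ^ 8 := by gcongr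
  have hτl0 : 0 < t₀ / s₀ * lam ^ 8 := by positivity
  rw [← hlam]
  have hlow : m * (t₁ / s₁ + t₀ / s₀ * lam ^ 8 - 2 * lam ^ 3) ≤
      6 / 10 * (1 - t₀ / s₀ * (t₁ / s₁)) := by
    rcases hcases with ⟨hτ, hσ⟩ | ⟨hr, hl⟩
    · have h1 : t₀ / s₀ * (t₁ / s₁) ≤ 3334 / 10000 * (5223 / 10000) := by gcongr
      calc m * (t₁ / s₁ + t₀ / s₀ * lam ^ 8 - 2 * lam ^ 3)
          ≤ m * (5223 / 10000 + 4753 / 10000 * (6 / 10) ^ 8) := by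
            gcongr
            linarith
        _ ≤ (1 + 5776 / 10000) / 2 * (5223 / 10000 + 4753 / 10000 * (6 / 10) ^ 8) := by gcongr
        _ ≤ 6 / 10 * (1 - 3334 / 10000 * (5223 / 10000)) := by norm_num
        _ ≤ _ := by gcongr
    · have h2 := hmle _ hr
      rw [← hlam] at hl
      have hl3l : (45 / 100 : ℝ) ^ 3 ≤ lam ^ 3 := by gcongr
      calc m * (t₁ / s₁ + t₀ / s₀ * lam ^ 8 - 2 * lam ^ 3)
          ≤ m * (6832 / 10000 + 4753 / 10000 * (6 / 10) ^ 8 - 2 * (45 / 100) ^ 3) := by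
            gcongr
        _ ≤ (1 + 5224 / 10000) / 2 *
            (6832 / 10000 + 4753 / 10000 * (6 / 10) ^ 8 - 2 * (45 / 100) ^ 3) := by
            gcongr
        _ ≤ 6 / 10 * (1 - 4753 / 10000 * (6832 / 10000)) := by norm_num
        _ ≤ _ := by gcongr
  have hupp : m * (2 * lam ^ 3 - t₁ / s₁ - t₀ / s₀ * lam ^ 8) ≤
      6 / 10 * (1 - t₀ / s₀ * (t₁ / s₁)) := by
    calc m * (2 * lam ^ 3 - t₁ / s₁ - t₀ / s₀ * lam ^ 8) ≤ m * (2 * (6 / 10) ^ 3) := by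
          gcongr
          linarith
      _ ≤ (1 + 5776 / 10000) / 2 * (2 * (6 / 10) ^ 3) := by gcongr
      _ ≤ 6 / 10 * (1 - 4753 / 10000 * (6832 / 10000)) := by norm_num
      _ ≤ _ := by gcongr
  obtain ⟨y, hy⟩ : ∃ y, y * (1 - t₀ / s₀ * (t₁ / s₁)) =
      m * (2 * lam ^ 3 - t₁ / s₁ - t₀ / s₀ * lam ^ 8) :=
    ⟨m * (2 * lam ^ 3 - t₁ / s₁ - t₀ / s₀ * lam ^ 8) / (1 - t₀ / s₀ * (t₁ / s₁)),
      div_mul_cancel₀ _ hden.ne'⟩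
  have hyu : y ≤ 6 / 10 := by
    rw [← hy] at hupp
    exact le_of_mul_le_mul_right hupp hden
  have hyl : -(6 / 10) ≤ y := by
    refine le_of_mul_le_mul_right (a := 1 - t₀ / s₀ * (t₁ / s₁)) ?_ hden
    rw [hy]
    linarith
  -- The target `6 / 10` fits both remaining conditions: `m < 0.789` gives `m ^ 2 + y ^ 2 < 1`, and
  -- it keeps the coefficient of `d` within `[-1, 1]`.
  have hyabs : |y| ≤ 6 / 10 := abs_le.2 ⟨hyl, hyu⟩
  refine splits_three_levels_of_ratios hs₀ ht₀ hs₁ ht₁ hs₀' ht₀' hs₁' hlam hm hy ?_ ?_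
  · have h1 : m ^ 2 ≤ ((1 + 5776 / 10000) / 2) ^ 2 := by gcongr
    have h2 : y ^ 2 ≤ (6 / 10) ^ 2 := sq_le_sq' hyl hyu
    norm_num at h1 h2 ⊢
    linarith
  · refine (abs_sub _ _).trans ?_
    rw [abs_mul, abs_mul, abs_of_pos hxl0, abs_of_pos hl8', abs_of_pos (by positivity)]
    calc lam / (2 * (s₀ * t₀)) * lam ^ 8 + 3 * (t₀ / s₀) * |y|
        ≤ 155 / 100 * (6 / 10) ^ 8 + 3 * (4753 / 10000) * (6 / 10) := by gcongr
      _ ≤ 1 := by norm_num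

/-- Below weight `3 / 10` the sum `u₀ + u₁` stays below its value at `3 / 10`. -/
lemma uN_three_add_le (h0 : 0 ≤ α) (h1 : α ≤ 3 / 10) :
    uN 3 0 α + uN 3 1 α ≤ uN 3 0 (3 / 10) + uN 3 1 (3 / 10) := by
  obtain ⟨c0, c1, -, -⟩ := coin_three
  have hα : α ∈ Set.Icc (0 : ℝ) 1 := ⟨h0, by linarith⟩
  have hβ : (3 / 10 : ℝ) ∈ Set.Icc (0 : ℝ) 1 := ⟨by norm_num, by norm_num⟩
  have a0 := uN_sq hα 3 0
  have a1 := uN_sq hα 3 1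
  have b0 := uN_sq hβ 3 0
  have b1 := uN_sq hβ 3 1
  rw [c0] at a0 b0
  rw [c1] at a1 b1
  have p0 : 0 ≤ uN 3 0 (3 / 10) := uN_nonneg _ _ _
  have p1 : 0 ≤ uN 3 1 (3 / 10) := uN_nonneg _ _ _
  have hx := sq_nonneg (uN 3 0 α - uN 3 0 (3 / 10))
  have hy := sq_nonneg (uN 3 1 α - uN 3 1 (3 / 10))
  generalize uN 3 0 α = x at *
  generalize uN 3 1 α = y at *
  generalize uN 3 0 (3 / 10) = u at *
  generalize uN 3 1 (3 / 10) = v at *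
  have hu : 0 < u := p0.lt_of_ne' fun h => by rw [h] at b0; norm_num at b0
  have hv : 0 < v := p1.lt_of_ne' fun h => by rw [h] at b1; norm_num at b1
  -- `9 / 320` and `-3 / 64` are the slopes of `u₀ ^ 2` and `u₁ ^ 2` at `3 / 10`. Both squares are
  -- concave in `α`, and `5 / 3` is the ratio of the slopes in absolute value, so the loss in `u₀`
  -- outweighs the gain in `u₁`.
  have huv : 5 / 3 * u ≤ v := by
    refine (abs_le_of_sq_le_sq' ?_ p1).2
    rw [mul_pow, b0, b1]; norm_num
  have d : 0 ≤ 3 / 10 - α := by linarith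
  have k0 : 2 * u * (x - u) ≤ -(9 / 320) * (3 / 10 - α) := by
    nlinarith only [hx, a0, b0, d]
  have k1 : 2 * v * (y - v) ≤ 3 / 64 * (3 / 10 - α) := by
    nlinarith only [hy, a1, b1, d]
  have k0' : 2 * v * (u * (x - u)) ≤ v * (-(9 / 320) * (3 / 10 - α)) := by
    nlinarith only [k0, hv]
  have k1' : 2 * u * (v * (y - v)) ≤ u * (3 / 64 * (3 / 10 - α)) := by
    nlinarith only [k1, hu]
  have k2 : u * (3 / 64 * (3 / 10 - α)) ≤ v * (9 / 320 * (3 / 10 - α)) := by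
    nlinarith only [huv, d]
  have k3 : 2 * (u * v) * (x + y - (u + v)) ≤ 0 := by nlinarith only [k0', k1', k2]
  have := nonpos_of_mul_nonpos_right k3 (by positivity)
  linarith

lemma splits_at_one {N : ℕ} : Splits N 1 (uN N 0 1 + uN N 1 1) := by
  rw [uN_one, uN_one, add_zero]
  exact splits_zero_right zero_le_one le_rfl

lemma splits_three_levels (hα : α ∈ Set.Icc (0 : ℝ) 1) : Splits 3 α (uN 3 0 α + uN 3 1 α) := by
  rcases hα.2.eq_or_lt with rfl | h1
  · exact splits_at_one
  rcases le_total (3 / 10) α with h | h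
  · exact splits_three_levels_of_le h h1
  · have hβ : (3 / 10 : ℝ) ∈ Set.Icc (0 : ℝ) 1 := ⟨by norm_num, by norm_num⟩
    have hm := uN_add_uN_mem (N := 3) (by norm_num) hβ
    have hm' := uN_add_uN_mem (N := 3) (by norm_num) hα
    -- Small weights need no new construction: the region is closed downwards in both variables.
    exact ((splits_three_levels_of_le le_rfl (by norm_num)).mono_right hm'.1
      (uN_three_add_le hα.1 h) hβ.1 hβ.2).mono_weight hm'.1 hm'.2 hα.1 h

end ThreeQubits

/-! ### Splittings for many levels -/

/-- A symmetric form is bounded through its absolute row sums. -/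
lemma abs_form_le_rowSum {n : Type*} [Fintype n] {S : n → n → ℝ}
    (hS : ∀ k l, S k l = S l k) (x : n → ℝ) :
    |∑ k, ∑ l, S k l * x k * x l| ≤ ∑ k, (∑ l, |S k l|) * x k ^ 2 := by
  have h1 : |∑ k, ∑ l, S k l * x k * x l| ≤
      ∑ k, ∑ l, |S k l| * ((x k ^ 2 + x l ^ 2) / 2) := by
    refine (Finset.abs_sum_le_sum_abs _ _).trans (Finset.sum_le_sum fun k _ => ?_)
    refine (Finset.abs_sum_le_sum_abs _ _).trans (Finset.sum_le_sum fun l _ => ?_)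
    rw [mul_assoc, abs_mul]
    gcongr
    rw [abs_mul, ← sq_abs (x k), ← sq_abs (x l)]
    nlinarith [sq_nonneg (|x k| - |x l|)]
  have h2 : ∑ k, ∑ l, |S k l| * x l ^ 2 = ∑ k, ∑ l, |S k l| * x k ^ 2 := by
    rw [Finset.sum_comm]
    refine Finset.sum_congr rfl fun k _ => Finset.sum_congr rfl fun l _ => ?_
    rw [hS]
  have h3 : ∑ k, ∑ l, |S k l| * ((x k ^ 2 + x l ^ 2) / 2) =
      (∑ k, ∑ l, |S k l| * x k ^ 2 + ∑ k, ∑ l, |S k l| * x l ^ 2) / 2 := by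
    rw [← Finset.sum_add_distrib, Finset.sum_div]
    refine Finset.sum_congr rfl fun k _ => ?_
    rw [← Finset.sum_add_distrib, Finset.sum_div]
    refine Finset.sum_congr rfl fun l _ => ?_
    ring
  rw [h3, h2] at h1
  refine h1.trans_eq ?_
  rw [add_self_div_two]
  exact Finset.sum_congr rfl fun k _ => (Finset.sum_mul _ _ _).symm

/-- A star-shaped form with centre `j`, perturbed by a small form away from the centre. -/
lemma star_form_nonneg {n : Type*} [Fintype n] [DecidableEq n] {j : n}
    {P q κ S : ℝ} {t x : n → ℝ} (hP : 0 < P) (htj : t j = 0)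
    (hS : -(κ * ∑ l ∈ univ.erase j, x l ^ 2) ≤ S) (hT : ∑ l, t l ^ 2 + P * κ ≤ P * q) :
    0 ≤ P * x j ^ 2 + q * ∑ l ∈ univ.erase j, x l ^ 2 + 2 * x j * ∑ l, t l * x l + S := by
  have h1 : ∑ l, t l * x l = ∑ l ∈ univ.erase j, t l * x l := by
    rw [← Finset.add_sum_erase univ _ (mem_univ j), htj]; simp
  have h2 : ∑ l, t l ^ 2 = ∑ l ∈ univ.erase j, t l ^ 2 := by
    rw [← Finset.add_sum_erase univ _ (mem_univ j), htj]; simp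
  have h3 := Finset.sum_mul_sq_le_sq_mul_sq (univ.erase j) t x
  rw [h2] at hT
  rw [h1]
  set X := ∑ l ∈ univ.erase j, x l ^ 2
  set W := ∑ l ∈ univ.erase j, t l * x l
  have hX : 0 ≤ X := Finset.sum_nonneg fun l _ => sq_nonneg _
  have h4 := mul_le_mul_of_nonneg_right hT hX
  have h5 := mul_le_mul_of_nonneg_left hS hP.le
  have h6 := sq_nonneg (P * x j + W)
  -- Multiplied by `P`, the form is at least `(P * x j + W) ^ 2 - W ^ 2 + (P * q - P * κ) * X`, and
  -- Cauchy–Schwarz bounds `W ^ 2` by `(∑ t l ^ 2) * X`.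
  refine nonneg_of_mul_nonneg_right (a := P) ?_ hP
  nlinarith only [h3, h4, h5, h6]

section ManyLevels

variable {N : ℕ} {α lam : ℝ}

/-- The two lowest and the two highest levels. -/
def IsOuter (N k : ℕ) : Prop := k ≤ 1 ∨ N ≤ k + 1

instance (N k : ℕ) : Decidable (IsOuter N k) := inferInstanceAs (Decidable (_ ∨ _))

/-- For an outer outcome `j`, the levels `k` on which its part has rank one. -/
def InBlock (N j k : ℕ) : Prop := (j ≤ 1 ∧ k ≤ j + 1) ∨ (N ≤ j + 1 ∧ j ≤ k + 1)

instance (N j k : ℕ) : Decidable (InBlock N j k) := inferInstanceAs (Decidable (_ ∨ _))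

/-- Rank one on the block of `j` and diagonal elsewhere. -/
noncomputable def blockPart (N : ℕ) (α : ℝ) (j : Fin (N + 1)) :
    Matrix (Fin (N + 1)) (Fin (N + 1)) ℝ :=
  Matrix.of fun k l => if k = l then mixProb N α j k else
    if InBlock N j k ∧ InBlock N j l then √(mixProb N α j k) * √(mixProb N α j l) else 0

/-- What the block parts leave of the Gaussian matrix. -/
noncomputable def residual (N : ℕ) (α lam : ℝ) (k l : Fin (N + 1)) : ℝ :=
  gauss N lam k l - ∑ j, blockPart N α j k l

/-- The share of a residual entry that is taken by the other index. -/
noncomputable def share (N k : ℕ) : ℝ := if IsOuter N k then 1 else 1 / 2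

/-- The corrections by which the inner outcomes take up the residual. -/
noncomputable def innerPart (N : ℕ) (α lam : ℝ) (j : Fin (N + 1)) :
    Matrix (Fin (N + 1)) (Fin (N + 1)) ℝ :=
  Matrix.of fun k l => if IsOuter N j then 0 else
    (if k = j then share N l * residual N α lam k l else 0) +
    (if l = j then share N k * residual N α lam k l else 0) +
    if (j : ℕ) = 2 ∧ IsOuter N k ∧ IsOuter N l then residual N α lam k l else 0

lemma blockPart_diag (j k : Fin (N + 1)) : blockPart N α j k k = mixProb N α j k := by
  simp [blockPart]

lemma blockPart_symm (j k l : Fin (N + 1)) : blockPart N α j k l = blockPart N α j l k := by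
  simp only [blockPart, Matrix.of_apply]
  by_cases h : k = l
  · subst h; rfl
  · rw [if_neg h, if_neg (Ne.symm h)]
    simp only [and_comm, mul_comm]

lemma residual_symm (k l : Fin (N + 1)) : residual N α lam k l = residual N α lam l k := by
  simp only [residual, gauss_symm N lam k l, blockPart_symm _ k l]

lemma residual_diag (k : Fin (N + 1)) : residual N α lam k k = 0 := by
  simp [residual, blockPart_diag, sum_mixProb]

lemma mixProb_rev (j k : Fin (N + 1)) : mixProb N α j.rev k.rev = mixProb N α j k := by
  have : coin N (N - j) = coin N j := by
    unfold coin
    rw [Nat.choose_symm (Nat.le_of_lt_succ j.2)]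
  simp [mixProb, Fin.val_rev, this]

lemma blockPart_rev (j k l : Fin (N + 1)) :
    blockPart N α j.rev k.rev l.rev = blockPart N α j k l := by
  have hb : ∀ i : Fin (N + 1), InBlock N (j.rev : ℕ) (i.rev : ℕ) ↔ InBlock N j i := fun i => by
    have := j.2
    have := i.2
    simp only [InBlock, Fin.val_rev]
    omega
  simp only [blockPart, Matrix.of_apply, Fin.rev_inj, mixProb_rev, hb]

/-- Reflection `k ↦ N - k` preserves the whole construction, so estimates are needed at one end of
the chain only. -/
lemma residual_rev (k l : Fin (N + 1)) :
    residual N α lam k.rev l.rev = residual N α lam k l := by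
  have h1 : ∑ j, blockPart N α j k.rev l.rev = ∑ j, blockPart N α j k l := by
    rw [← Equiv.sum_comp Fin.revPerm]
    exact Finset.sum_congr rfl fun j _ => blockPart_rev j k l
  have h2 : gauss N lam k.rev l.rev = gauss N lam k l := by
    rw [gauss_symm, gauss_apply, gauss_apply]
    congr 2
    simp only [Fin.val_rev]
    omega
  rw [residual, residual, h1, h2]

lemma sqrt_mixProb_mul_of_ne (hα : α ∈ Set.Icc (0 : ℝ) 1) {j k l : Fin (N + 1)} (hk : k ≠ j)
    (hl : l ≠ j) : √(mixProb N α j k) * √(mixProb N α j l) = (1 - α) * coin N j := by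
  have := mul_nonneg (sub_nonneg.2 hα.2) (coin_nonneg N j)
  simp [mixProb, hk, hl, Real.mul_self_sqrt this]

lemma sqrt_mixProb_mul_self (hα : α ∈ Set.Icc (0 : ℝ) 1) {j k : Fin (N + 1)} (hk : k ≠ j) :
    √(mixProb N α j j) * √(mixProb N α j k) = uN N j α := by
  rw [uN_eq_mul hα, mul_comm]
  simp [mixProb, hk, mul_comm]

lemma residual_eq_gauss {k l : Fin (N + 1)} (hkl : k ≠ l)
    (h : ∀ j ≤ N, ¬(InBlock N j k ∧ InBlock N j l)) : residual N α lam k l = gauss N lam k l := by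
  rw [residual, Finset.sum_eq_zero fun j _ => ?_, sub_zero]
  simp only [blockPart, Matrix.of_apply]
  rw [if_neg hkl, if_neg (h j (Nat.le_of_lt_succ j.2))]

/-- This is where `lam = u₀ + u₁` enters: the blocks of outcomes `0` and `1` produce the entry
exactly. -/
lemma residual_zero_one (hN : 4 ≤ N) (hα : α ∈ Set.Icc (0 : ℝ) 1)
    (hlam : lam = uN N 0 α + uN N 1 α) {k l : Fin (N + 1)} (hk : (k : ℕ) = 0) (hl : (l : ℕ) = 1) :
    residual N α lam k l = 0 := by
  have hkl : k ≠ l := fun h => by rw [h] at hk; omega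
  rw [residual, Fintype.sum_eq_add k l hkl, gauss_apply, hk, hl]
  · simp only [blockPart, Matrix.of_apply, if_neg hkl]
    rw [if_pos (by simp only [InBlock]; omega), if_pos (by simp only [InBlock]; omega),
      sqrt_mixProb_mul_self hα hkl.symm, mul_comm, sqrt_mixProb_mul_self hα hkl, hk, hl, ← hlam]
    simp
  · rintro j ⟨hjk, hjl⟩
    simp only [blockPart, Matrix.of_apply, if_neg hkl]
    refine if_neg ?_
    have h1 : (j : ℕ) ≠ k := fun h => hjk (Fin.ext h)
    have h2 : (j : ℕ) ≠ l := fun h => hjl (Fin.ext h)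
    simp only [InBlock]
    omega

lemma residual_two_one (hN : 4 ≤ N) (hα : α ∈ Set.Icc (0 : ℝ) 1)
    (hlam : lam = uN N 0 α + uN N 1 α) {k l : Fin (N + 1)} (hk : (k : ℕ) = 2) (hl : (l : ℕ) = 1) :
    residual N α lam k l = uN N 0 α := by
  have hkl : k ≠ l := fun h => by rw [h] at hk; omega
  rw [residual, Fintype.sum_eq_single l, gauss_apply, hk, hl]
  · simp only [blockPart, Matrix.of_apply, if_neg hkl]
    rw [if_pos (by simp only [InBlock]; omega), mul_comm, sqrt_mixProb_mul_self hα hkl, hl]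
    norm_num
    linarith
  · rintro j hjl
    simp only [blockPart, Matrix.of_apply, if_neg hkl]
    refine if_neg ?_
    have h2 : (j : ℕ) ≠ l := fun h => hjl (Fin.ext h)
    simp only [InBlock]
    omega

lemma residual_two_zero (hN : 4 ≤ N) (hα : α ∈ Set.Icc (0 : ℝ) 1)
    {k l : Fin (N + 1)} (hk : (k : ℕ) = 2) (hl : (l : ℕ) = 0) :
    residual N α lam k l = lam ^ 4 - (1 - α) * coin N 1 := by
  have hkl : k ≠ l := fun h => by rw [h] at hk; omega
  let o : Fin (N + 1) := ⟨1, by omega⟩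
  have hko : k ≠ o := fun h => by rw [h] at hk; simp [o] at hk
  have hlo : l ≠ o := fun h => by rw [h] at hl; simp [o] at hl
  rw [residual, Fintype.sum_eq_single o, gauss_apply, hk, hl]
  · simp only [blockPart, Matrix.of_apply, if_neg hkl]
    rw [if_pos (by simp only [InBlock, o]; omega), sqrt_mixProb_mul_of_ne hα hko hlo]
    norm_num [o]
  · rintro j hjo
    simp only [blockPart, Matrix.of_apply, if_neg hkl]
    refine if_neg ?_
    have h2 : (j : ℕ) ≠ 1 := fun h => hjo (Fin.ext h)
    simp only [InBlock]
    omega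

/-- Within one end nothing is left over; levels from opposite ends are at least `N - 2` apart and no
block contains both. -/
lemma abs_residual_outer_le (hN : 4 ≤ N) (hα : α ∈ Set.Icc (0 : ℝ) 1)
    (hlam : lam = uN N 0 α + uN N 1 α) {k l : Fin (N + 1)} (hk : IsOuter N k)
    (hl : IsOuter N l) : |residual N α lam k l| ≤
      if ((k : ℕ) ≤ 1 ↔ (l : ℕ) ≤ 1) then 0 else lam ^ ((N - 2) ^ 2) := by
  have hmem := uN_add_uN_mem (N := N) (by omega) hα
  rw [← hlam] at hmem
  have hk2 := k.2
  have hl2 := l.2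
  simp only [IsOuter] at hk hl
  rcases eq_or_ne k l with rfl | hkl
  · simp [residual_diag]
  have hkl' : (k : ℕ) ≠ l := fun h => hkl (Fin.ext h)
  split_ifs with h
  · suffices residual N α lam k l = 0 by simp [this]
    by_cases hk1 : (k : ℕ) ≤ 1
    · have := h.1 hk1
      rcases (by omega : ((k : ℕ) = 0 ∧ (l : ℕ) = 1) ∨ ((l : ℕ) = 0 ∧ (k : ℕ) = 1)) with h' | h'
      · exact residual_zero_one hN hα hlam h'.1 h'.2
      · rw [residual_symm]
        exact residual_zero_one hN hα hlam h'.1 h'.2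
    · have hl1 : ¬(l : ℕ) ≤ 1 := fun h' => hk1 (h.2 h')
      rw [← residual_rev]
      have e1 := Fin.val_rev k
      have e2 := Fin.val_rev l
      rcases (by omega : ((k.rev : ℕ) = 0 ∧ (l.rev : ℕ) = 1) ∨
        ((l.rev : ℕ) = 0 ∧ (k.rev : ℕ) = 1)) with h' | h'
      · exact residual_zero_one hN hα hlam h'.1 h'.2
      · rw [residual_symm]
        exact residual_zero_one hN hα hlam h'.1 h'.2
  · rw [residual_eq_gauss hkl (by intro j hj; simp only [InBlock]; omega), gauss_apply,
      abs_of_nonneg (pow_nonneg hmem.1 _)]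
    refine pow_le_pow_of_le_one hmem.1 hmem.2 (Nat.pow_le_pow_left ?_ 2)
    omega

lemma sum_abs_residual_outer_le (hN : 4 ≤ N) (hα : α ∈ Set.Icc (0 : ℝ) 1)
    (hlam : lam = uN N 0 α + uN N 1 α) (k : Fin (N + 1)) :
    ∑ l : Fin (N + 1), |if IsOuter N k ∧ IsOuter N l then residual N α lam k l else 0| ≤
      2 * lam ^ ((N - 2) ^ 2) := by
  have hmem := uN_add_uN_mem (N := N) (by omega) hα
  rw [← hlam] at hmem
  have hr : 0 ≤ lam ^ ((N - 2) ^ 2) := pow_nonneg hmem.1 _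
  obtain ⟨a, b, hab⟩ : ∃ a b : Fin (N + 1), ∀ l : Fin (N + 1), IsOuter N l →
      ¬((k : ℕ) ≤ 1 ↔ (l : ℕ) ≤ 1) → l = a ∨ l = b := by
    by_cases hk : (k : ℕ) ≤ 1
    · refine ⟨⟨N - 1, by omega⟩, ⟨N, by omega⟩, fun l hl h => ?_⟩
      simp only [Fin.ext_iff]
      simp only [IsOuter] at hl
      omega
    · refine ⟨⟨0, by omega⟩, ⟨1, by omega⟩, fun l hl h => ?_⟩
      simp only [Fin.ext_iff]
      simp only [IsOuter] at hl
      omega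
  have hle : ∀ l : Fin (N + 1),
      |if IsOuter N k ∧ IsOuter N l then residual N α lam k l else 0| ≤
      (if l = a then lam ^ ((N - 2) ^ 2) else 0) + if l = b then lam ^ ((N - 2) ^ 2) else 0 := by
    intro l
    have hnn : 0 ≤ (if l = a then lam ^ ((N - 2) ^ 2) else 0) +
        if l = b then lam ^ ((N - 2) ^ 2) else 0 := by split_ifs <;> positivity
    by_cases h : IsOuter N k ∧ IsOuter N l
    swap
    · rwa [if_neg h, abs_zero]
    rw [if_pos h]
    refine (abs_residual_outer_le hN hα hlam h.1 h.2).trans ?_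
    by_cases h2 : ((k : ℕ) ≤ 1 ↔ (l : ℕ) ≤ 1)
    · rwa [if_pos h2]
    · rw [if_neg h2]
      rcases hab l h.2 h2 with h3 | h3
      · rw [if_pos h3]
        split_ifs <;> linarith
      · rw [if_pos h3]
        split_ifs <;> linarith
  refine (Finset.sum_le_sum fun l _ => hle l).trans_eq ?_
  rw [Finset.sum_add_distrib, Finset.sum_ite_eq', Finset.sum_ite_eq', if_pos (mem_univ _),
    if_pos (mem_univ _), two_mul]

/-- Each entry is distributed exactly once: halved between two inner levels, given to the inner one
of a mixed pair, and given to outcome `2` if both levels are outer. -/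
lemma sum_innerPart (hN : 4 ≤ N) (k l : Fin (N + 1)) :
    ∑ j, innerPart N α lam j k l = residual N α lam k l := by
  let o : Fin (N + 1) := ⟨2, by omega⟩
  have ho : ¬IsOuter N (o : ℕ) := by simp only [IsOuter, o]; omega
  have h : ∀ j, innerPart N α lam j k l =
      (if k = j then (if IsOuter N k then 0 else share N l * residual N α lam k l) else 0) +
      (if l = j then (if IsOuter N l then 0 else share N k * residual N α lam k l) else 0) +
      (if j = o then (if IsOuter N k ∧ IsOuter N l then residual N α lam k l else 0) else 0) := by
    intro j
    simp only [innerPart, Matrix.of_apply]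
    have e3 : (j : ℕ) = 2 ↔ j = o := by simp [Fin.ext_iff, o]
    by_cases hj : IsOuter N j
    · have hjo : j ≠ o := fun h => ho (h ▸ hj)
      rw [if_pos hj, if_neg hjo]
      by_cases hk : k = j
      · subst hk
        by_cases hl : l = k
        · subst hl; simp [hj]
        · simp [hj, hl]
      · by_cases hl : l = j
        · subst hl; simp [hj, hk]
        · simp [hk, hl]
    · rw [if_neg hj]
      congr 1
      · congr 1
        · by_cases hk : k = j
          · subst hk; simp [hj]
          · simp [hk]
        · by_cases hl : l = j
          · subst hl; simp [hj]
          · simp [hl]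
      · simp only [e3, ite_and]
  simp_rw [h]
  rw [Finset.sum_add_distrib, Finset.sum_add_distrib, Finset.sum_ite_eq, Finset.sum_ite_eq,
    Finset.sum_ite_eq', if_pos (mem_univ _), if_pos (mem_univ _), if_pos (mem_univ _)]
  simp only [share]
  by_cases hk : IsOuter N k <;> by_cases hl : IsOuter N l <;> simp [hk, hl] <;> ring

lemma innerPart_diag (j k : Fin (N + 1)) : innerPart N α lam j k k = 0 := by
  simp [innerPart, residual_diag]

lemma innerPart_symm (j k l : Fin (N + 1)) :
    innerPart N α lam j k l = innerPart N α lam j l k := by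
  simp only [innerPart, Matrix.of_apply, residual_symm k l, and_comm (a := IsOuter N k)]
  split_ifs <;> ring

lemma posSemidef_blockPart (hα : α ∈ Set.Icc (0 : ℝ) 1) (j : Fin (N + 1)) :
    (blockPart N α j).PosSemidef := by
  have hp := fun k => mixProb_nonneg hα.1 hα.2 j k
  have : blockPart N α j =
      Matrix.vecMulVec (fun k : Fin (N + 1) => if InBlock N j k then √(mixProb N α j k) else 0)
        (star fun k : Fin (N + 1) => if InBlock N j k then √(mixProb N α j k) else 0) +
      Matrix.diagonal fun k : Fin (N + 1) => if InBlock N j k then 0 else mixProb N α j k := by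
    ext k l
    simp only [blockPart, Matrix.of_apply, Matrix.add_apply, Matrix.vecMulVec_apply, star_trivial]
    rcases eq_or_ne k l with rfl | hkl
    · rw [Matrix.diagonal_apply_eq, if_pos rfl]
      split_ifs
      · rw [Real.mul_self_sqrt (hp k), add_zero]
      · simp
    · rw [Matrix.diagonal_apply_ne _ hkl, if_neg hkl]
      by_cases h1 : InBlock N j k <;> by_cases h2 : InBlock N j l <;> simp [h1, h2]
  rw [this]
  refine (Matrix.posSemidef_vecMulVec_self_star _).add (Matrix.posSemidef_diagonal_iff.2 fun k => ?_)
  split_ifs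
  · exact le_rfl
  · exact hp k

lemma blockPart_eq_diagonal {j : Fin (N + 1)} (hj : ¬IsOuter N j) :
    blockPart N α j = Matrix.diagonal (mixProb N α j) := by
  ext k l
  have : ¬(InBlock N j k ∧ InBlock N j l) := by
    simp only [IsOuter, InBlock] at hj ⊢
    omega
  simp only [blockPart, Matrix.of_apply, Matrix.diagonal_apply, if_neg this]

/-- The splitting exists once every inner outcome can carry its share of the residual. -/
lemma splits_of_residual_le (hN : 4 ≤ N) (hα : α ∈ Set.Icc (0 : ℝ) 1)
    (hlam : lam = uN N 0 α + uN N 1 α)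
    (h : ∀ j : Fin (N + 1), ¬IsOuter N j →
      ∑ l : Fin (N + 1), (share N l * residual N α lam j l) ^ 2 +
        (α + (1 - α) * coin N j) * (2 * lam ^ ((N - 2) ^ 2)) ≤
        (α + (1 - α) * coin N j) * ((1 - α) * coin N j)) :
    Splits N α lam := by
  have hmem := uN_add_uN_mem (N := N) (by omega) hα
  rw [← hlam] at hmem
  refine splits_of_offDiag (C := fun j => blockPart N α j + innerPart N α lam j) (fun j => ?_)
    (fun j k => by rw [Matrix.add_apply, blockPart_diag, innerPart_diag, add_zero])
    (fun k l hkl => ?_)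
  swap
  · simp only [Matrix.add_apply]
    rw [Finset.sum_add_distrib, sum_innerPart hN, residual]
    ring
  by_cases hj : IsOuter N j
  · have : innerPart N α lam j = 0 := by
      ext k l
      simp [innerPart, hj]
    rw [this, add_zero]
    exact posSemidef_blockPart hα j
  refine posSemidef_of_symm_of_nonneg
    (fun k l => by rw [Matrix.add_apply, Matrix.add_apply, blockPart_symm, innerPart_symm])
    fun x => ?_
  have hc : 0 < coin N j := coin_pos (Nat.le_of_lt_succ j.2)
  have hP : 0 < α + (1 - α) * coin N j := by
    rcases hα.1.eq_or_lt with h0 | h0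
    · rw [← h0]; simpa using hc
    · have := mul_nonneg (sub_nonneg.2 hα.2) hc.le
      linarith
  let S : Fin (N + 1) → Fin (N + 1) → ℝ := fun k l =>
    if (j : ℕ) = 2 ∧ IsOuter N k ∧ IsOuter N l then residual N α lam k l else 0
  have hS : -((2 * lam ^ ((N - 2) ^ 2)) * ∑ l ∈ univ.erase j, x l ^ 2) ≤
      ∑ k, ∑ l, S k l * x k * x l := by
    refine (abs_le.1 ((abs_form_le_rowSum (S := S) (fun k l => ?_) x).trans ?_)).1
    · simp only [S, residual_symm k l, and_comm (a := IsOuter N k)]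
    · have hrow : ∀ k, ∑ l, |S k l| ≤ 2 * lam ^ ((N - 2) ^ 2) := fun k => by
        refine (Finset.sum_le_sum fun l _ => ?_).trans (sum_abs_residual_outer_le hN hα hlam k)
        simp only [S]
        by_cases h2 : (j : ℕ) = 2
        · simp [h2]
        · simp [h2]
      -- The centre is an inner level, so the outer-outer correction does not touch it, as
      -- `star_form_nonneg` requires.
      have hjrow : ∑ l, |S j l| = 0 := by simp [S, hj]
      rw [← Finset.add_sum_erase univ _ (mem_univ j), hjrow, zero_mul, zero_add, Finset.mul_sum]
      exact Finset.sum_le_sum fun k _ => mul_le_mul_of_nonneg_right (hrow k) (sq_nonneg _)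
  have key := star_form_nonneg (j := j) (x := x) hP
    (t := fun l => share N l * residual N α lam j l)
    (by rw [residual_diag, mul_zero]) hS (h j hj)
  refine key.trans_eq ?_
  have e1 : ∑ k, ∑ l, blockPart N α j k l * x k * x l =
      (α + (1 - α) * coin N j) * x j ^ 2 +
        (1 - α) * coin N j * ∑ l ∈ univ.erase j, x l ^ 2 := by
    rw [blockPart_eq_diagonal hj]
    have : ∀ k, ∑ l, Matrix.diagonal (mixProb N α j) k l * x k * x l =
        mixProb N α j k * x k ^ 2 := fun k => by
      rw [Fintype.sum_eq_single k fun l hl => by rw [Matrix.diagonal_apply_ne _ hl.symm]; ring,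
        Matrix.diagonal_apply_eq]
      ring
    simp_rw [this]
    rw [← Finset.add_sum_erase univ _ (mem_univ j), Finset.mul_sum]
    congr 1
    · simp [mixProb]
    · refine Finset.sum_congr rfl fun l hl => ?_
      simp [mixProb, Finset.ne_of_mem_erase hl]
  have e2 : ∑ k, ∑ l, innerPart N α lam j k l * x k * x l =
      2 * x j * ∑ l : Fin (N + 1), share N l * residual N α lam j l * x l + ∑ k, ∑ l, S k l * x k * x l := by
    have hin : ∀ k l, innerPart N α lam j k l * x k * x l =
        (if k = j then share N l * residual N α lam k l * x k * x l else 0) +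
        (if l = j then share N k * residual N α lam k l * x k * x l else 0) +
        S k l * x k * x l := fun k l => by
      simp only [innerPart, Matrix.of_apply, if_neg hj, S]
      by_cases h1 : k = j <;> by_cases h2 : l = j <;> simp only [h1, h2, if_true, if_false] <;> ring
    simp_rw [hin, Finset.sum_add_distrib]
    congr 1
    rw [Finset.sum_comm (f := fun k l => if k = j then _ else _)]
    simp only [Finset.sum_ite_eq', mem_univ, if_true]
    rw [← Finset.sum_add_distrib, Finset.mul_sum]
    refine Finset.sum_congr rfl fun l _ => ?_
    rw [residual_symm l j]
    ring
  have e3 : ∑ k, ∑ l, (blockPart N α j + innerPart N α lam j) k l * x k * x l =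
      ∑ k, ∑ l, blockPart N α j k l * x k * x l + ∑ k, ∑ l, innerPart N α lam j k l * x k * x l := by
    simp only [Matrix.add_apply, add_mul, Finset.sum_add_distrib]
  rw [e3, e1, e2, add_assoc]

end ManyLevels

/-! ### Estimating the residual, and the splittings for `N ≥ 4` -/

section ManyLevelsBounds

variable {N : ℕ} {α lam : ℝ}

lemma sum_ite_le_of_unique {n : Type*} [Fintype n] {P : n → Prop} [DecidablePred P] {b : ℝ}
    (hP : ∀ k l, P k → P l → k = l) (hb : 0 ≤ b) : ∑ l, (if P l then b else 0) ≤ b := by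
  rw [← Finset.sum_filter, Finset.sum_const, nsmul_eq_mul]
  have : (univ.filter P).card ≤ 1 :=
    Finset.card_le_one.2 fun k hk l hl => hP k l (mem_filter.1 hk).2 (mem_filter.1 hl).2
  have h2 : ((univ.filter P).card : ℝ) ≤ 1 := by exact_mod_cast this
  nlinarith

/-- Size of the residual below the centre of an inner outcome. -/
lemma share_mul_residual_sq_le_of_lt (hN : 4 ≤ N) (hα : α ∈ Set.Icc (0 : ℝ) 1)
    (hlam : lam = uN N 0 α + uN N 1 α) {j l : Fin (N + 1)} (hj : ¬IsOuter N j)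
    (hlj : (l : ℕ) < j) : (share N l * residual N α lam j l) ^ 2 ≤ lam ^ 8 +
      (if (l : ℕ) + 1 = j then lam ^ 2 / 4 + uN N 0 α ^ 2 else 0) +
      if (l : ℕ) + 2 = j then ((1 - α) * coin N 1) ^ 2 else 0 := by
  have hmem := uN_add_uN_mem (N := N) (by omega) hα
  rw [← hlam] at hmem
  have hl0 := hmem.1
  have hq := mul_nonneg (sub_nonneg.2 hα.2) (coin_nonneg N 1)
  have hu := sq_nonneg (uN N 0 α)
  have hjl : j ≠ l := fun h => by rw [h] at hlj; omega
  have hshare : share N l ^ 2 ≤ 1 := by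
    unfold share; split_ifs <;> norm_num
  simp only [IsOuter] at hj
  have h8 : 0 ≤ lam ^ 8 := by positivity
  by_cases hj2 : (j : ℕ) = 2 ∧ (l : ℕ) ≤ 1
  · obtain ⟨hj2, hl1⟩ := hj2
    have hsh : share N l = 1 := by
      rw [share, if_pos (by simp only [IsOuter]; omega)]
    rw [hsh, one_mul]
    rcases (by omega : (l : ℕ) = 0 ∨ (l : ℕ) = 1) with hl | hl
    · rw [residual_two_zero hN hα hj2 hl, if_neg (by omega), if_pos (by omega)]
      have := mul_nonneg (pow_nonneg hl0 4) hq
      nlinarith only [this]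
    · rw [residual_two_one hN hα hlam hj2 hl, if_pos (by omega), if_neg (by omega)]
      have := sq_nonneg lam
      linarith
  · rw [residual_eq_gauss hjl (by intro i hi; simp only [InBlock]; omega), gauss_apply, mul_pow,
      ← pow_mul]
    have hd : ((j : ℤ) - (l : ℤ)).natAbs = (j : ℕ) - l := by omega
    rw [hd]
    by_cases h1 : (l : ℕ) + 1 = j
    · have hsh : share N l = 1 / 2 := by
        rw [share, if_neg (by simp only [IsOuter]; omega)]
      rw [if_pos h1, if_neg (by omega), hsh, ← h1, Nat.add_sub_cancel_left]
      norm_num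
      linarith
    · rw [if_neg h1, add_zero]
      have hpow : lam ^ (((j : ℕ) - l) ^ 2 * 2) ≤ lam ^ 8 := by
        refine pow_le_pow_of_le_one hl0 hmem.2 ?_
        have : 2 ^ 2 ≤ ((j : ℕ) - l) ^ 2 := Nat.pow_le_pow_left (by omega) 2
        omega
      have h3 : share N l ^ 2 * lam ^ (((j : ℕ) - l) ^ 2 * 2) ≤ 1 * lam ^ 8 := by
        gcongr
      have h4 : 0 ≤ if (l : ℕ) + 2 = j then ((1 - α) * coin N 1) ^ 2 else 0 := by
        split_ifs <;> positivity
      linarith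

lemma share_rev (k : Fin (N + 1)) : share N (k.rev : ℕ) = share N k := by
  have : IsOuter N (k.rev : ℕ) ↔ IsOuter N k := by
    have := k.2
    simp only [IsOuter, Fin.val_rev]
    omega
  simp only [share, this]

lemma sum_share_mul_residual_sq_le (hN : 4 ≤ N) (hα : α ∈ Set.Icc (0 : ℝ) 1)
    (hlam : lam = uN N 0 α + uN N 1 α) {j : Fin (N + 1)} (hj : ¬IsOuter N j) :
    ∑ l : Fin (N + 1), (share N l * residual N α lam j l) ^ 2 ≤ (N + 1) * lam ^ 8 +
      lam ^ 2 / 2 + 2 * uN N 0 α ^ 2 + 2 * ((1 - α) * coin N 1) ^ 2 := by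
  have hb1 : 0 ≤ lam ^ 2 / 4 + uN N 0 α ^ 2 := by positivity
  have hb2 : 0 ≤ ((1 - α) * coin N 1) ^ 2 := by positivity
  have h8 : 0 ≤ lam ^ 8 := by positivity
  have hle : ∀ l : Fin (N + 1), (share N l * residual N α lam j l) ^ 2 ≤ lam ^ 8 +
      (if (l : ℕ) + 1 = j then lam ^ 2 / 4 + uN N 0 α ^ 2 else 0) +
      (if (l : ℕ) + 2 = j then ((1 - α) * coin N 1) ^ 2 else 0) +
      (if (j : ℕ) + 1 = l then lam ^ 2 / 4 + uN N 0 α ^ 2 else 0) +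
      (if (j : ℕ) + 2 = l then ((1 - α) * coin N 1) ^ 2 else 0) := fun l => by
    rcases lt_trichotomy (l : ℕ) (j : ℕ) with h | h | h
    · rw [if_neg (by omega : ¬(j : ℕ) + 1 = l), if_neg (by omega : ¬(j : ℕ) + 2 = l), add_zero,
        add_zero]
      exact share_mul_residual_sq_le_of_lt hN hα hlam hj h
    · have : l = j := Fin.ext h
      subst this
      rw [residual_diag]
      simp only [mul_zero, ne_eq, OfNat.ofNat_ne_zero, not_false_eq_true, zero_pow]
      split_ifs <;> linarith
    · have hj2 := j.2
      have hl2 := l.2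
      have := share_mul_residual_sq_le_of_lt hN hα hlam (j := j.rev) (l := l.rev)
        (by simp only [IsOuter, Fin.val_rev] at hj ⊢; omega)
        (by simp only [Fin.val_rev]; omega)
      rw [share_rev, residual_rev] at this
      have e1 : (l.rev : ℕ) + 1 = j.rev ↔ (j : ℕ) + 1 = l := by
        simp only [Fin.val_rev]; omega
      have e2 : (l.rev : ℕ) + 2 = j.rev ↔ (j : ℕ) + 2 = l := by
        simp only [Fin.val_rev]; omega
      simp only [e1, e2] at this
      rw [if_neg (by omega : ¬(l : ℕ) + 1 = j), if_neg (by omega : ¬(l : ℕ) + 2 = j), add_zero,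
        add_zero]
      exact this
  refine (Finset.sum_le_sum fun l _ => hle l).trans ?_
  simp only [Finset.sum_add_distrib]
  have s1 := sum_ite_le_of_unique (n := Fin (N + 1)) (P := fun l => (l : ℕ) + 1 = j)
    (fun k l hk hl => Fin.ext (by omega)) hb1
  have s2 := sum_ite_le_of_unique (n := Fin (N + 1)) (P := fun l => (l : ℕ) + 2 = j)
    (fun k l hk hl => Fin.ext (by omega)) hb2
  have s3 := sum_ite_le_of_unique (n := Fin (N + 1)) (P := fun l => (j : ℕ) + 1 = l)
    (fun k l hk hl => Fin.ext (by omega)) hb1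
  have s4 := sum_ite_le_of_unique (n := Fin (N + 1)) (P := fun l => (j : ℕ) + 2 = l)
    (fun k l hk hl => Fin.ext (by omega)) hb2
  have s5 : ∑ _l : Fin (N + 1), lam ^ 8 = (N + 1) * lam ^ 8 := by simp
  rw [s5]
  linarith

/-- AM–GM for the cross term: with `a = c₀ (1 - α)` and `b = c₁ (1 - α)`, the product `u₀² u₁²`
regroups as `a (α + b) * b (α + a)`. -/
lemma uN_add_uN_sq_le (hα : α ∈ Set.Icc (0 : ℝ) 1) :
    (uN N 0 α + uN N 1 α) ^ 2 ≤ (coin N 0 + coin N 1) * (1 - α) *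
      (2 * α + (coin N 0 + coin N 1) * (1 - α)) := by
  have h0 := uN_sq hα N 0
  have h1 := uN_sq hα N 1
  have hq0 := mul_nonneg (coin_nonneg N 0) (sub_nonneg.2 hα.2)
  have hq1 := mul_nonneg (coin_nonneg N 1) (sub_nonneg.2 hα.2)
  have hα0 := hα.1
  set a := coin N 0 * (1 - α) with ha
  set b := coin N 1 * (1 - α) with hb
  have key : 2 * (uN N 0 α * uN N 1 α) ≤ a * (α + b) + b * (α + a) := by
    refine (abs_le_of_sq_le_sq' ?_ (by positivity)).2
    have : (2 * (uN N 0 α * uN N 1 α)) ^ 2 = 4 * (a * (α + b) * (b * (α + a))) := by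
      rw [mul_pow, mul_pow, h0, h1]; ring
    rw [this]
    nlinarith only [sq_nonneg (a * (α + b) - b * (α + a))]
  have e : (coin N 0 + coin N 1) * (1 - α) = a + b := by rw [ha, hb]; ring
  rw [e]
  nlinarith only [key, h0, h1]

lemma choose_two_le_choose {N j : ℕ} (h2 : 2 ≤ j) (hj : j + 2 ≤ N) :
    N.choose 2 ≤ N.choose j := by
  have key : ∀ i, 2 ≤ i → 2 * i ≤ N → N.choose 2 ≤ N.choose i := by
    intro i hi
    induction i, hi using Nat.le_induction with
    | base => intro _; exact le_rfl
    | succ i hi ih =>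
      intro h
      exact (ih (by omega)).trans (Nat.choose_le_succ_of_lt_half_left (by omega))
  rcases le_total (2 * j) N with h | h
  · exact key j h2 h
  · rw [← Nat.choose_symm (by omega : j ≤ N)]
    exact key (N - j) (by omega) (by omega)

lemma coin_two_le_coin {j : ℕ} (h2 : 2 ≤ j) (hj : j + 2 ≤ N) : coin N 2 ≤ coin N j := by
  unfold coin
  gcongr
  exact choose_two_le_choose h2 hj

lemma splits_four_levels (hα : α ∈ Set.Icc (0 : ℝ) 1) :
    Splits 4 α (uN 4 0 α + uN 4 1 α) := by
  obtain ⟨c0, c1, c2⟩ : coin 4 0 = 1 / 16 ∧ coin 4 1 = 1 / 4 ∧ coin 4 2 = 3 / 8 := by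
    norm_num [coin, Nat.choose]
  obtain ⟨lam, hlam⟩ : ∃ lam, lam = uN 4 0 α + uN 4 1 α := ⟨_, rfl⟩
  rw [← hlam]
  have hsq := uN_add_uN_sq_le (N := 4) hα
  rw [← hlam, c0, c1] at hsq
  have hu := uN_sq hα 4 0
  rw [c0] at hu
  refine splits_of_residual_le le_rfl hα hlam fun j hj => ?_
  have hj2 : j = 2 := by
    have := j.2
    simp only [IsOuter] at hj
    apply Fin.ext
    change (j : ℕ) = 2
    omega
  subst hj2
  have r0 : residual 4 α lam 2 0 = lam ^ 4 - (1 - α) * coin 4 1 :=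
    residual_two_zero le_rfl hα rfl rfl
  have r1 : residual 4 α lam 2 1 = uN 4 0 α := residual_two_one le_rfl hα hlam rfl rfl
  have r3 : residual 4 α lam 2 3 = uN 4 0 α := by
    rw [← r1, ← residual_rev]; rfl
  have r4 : residual 4 α lam 2 4 = lam ^ 4 - (1 - α) * coin 4 1 := by
    rw [← r0, ← residual_rev]; rfl
  have hsum : ∑ l : Fin 5, (share 4 l * residual 4 α lam 2 l) ^ 2 =
      2 * (lam ^ 4 - (1 - α) * coin 4 1) ^ 2 + 2 * uN 4 0 α ^ 2 := by
    rw [Fin.sum_univ_five, r0, r1, r3, r4, residual_diag]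
    simp [share, IsOuter]
    ring
  have hc : coin 4 ((2 : Fin (4 + 1)) : ℕ) = 3 / 8 := c2
  rw [hsum, hc, c1, hu]
  obtain ⟨h0, h1⟩ := hα
  have he := sub_nonneg.2 h1
  have hL0 : 0 ≤ lam ^ 2 := sq_nonneg _
  have h4 : lam ^ 4 ≤ ((1 / 16 + 1 / 4) * (1 - α) * (2 * α + (1 / 16 + 1 / 4) * (1 - α))) ^ 2 := by
    calc lam ^ 4 = (lam ^ 2) ^ 2 := by ring
      _ ≤ _ := by gcongr
  have h40 : 0 ≤ lam ^ 4 := by positivity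
  -- It suffices that `lam ^ 4` lies between `0` and twice the number subtracted.
  have hq : (lam ^ 4 - (1 - α) * (1 / 4)) ^ 2 ≤ ((1 - α) * (1 / 4)) ^ 2 := by
    have hb : (2 * α + (1 / 16 + 1 / 4) * (1 - α)) ^ 2 ≤ 2 ^ 2 := by
      gcongr
      linarith
    have hc : lam ^ 4 ≤ (1 - α) * (1 / 2) := by
      refine h4.trans ?_
      rw [mul_pow]
      calc ((1 / 16 + 1 / 4) * (1 - α)) ^ 2 * (2 * α + (1 / 16 + 1 / 4) * (1 - α)) ^ 2
          ≤ ((1 / 16 + 1 / 4) * (1 - α)) ^ 2 * 2 ^ 2 := by gcongr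
        _ ≤ (1 - α) * (1 / 2) := by nlinarith only [he, h0]
    refine sq_le_sq' ?_ ?_ <;> linarith
  have hpow : lam ^ ((4 - 2) ^ 2) = lam ^ 4 := rfl
  rw [hpow]
  have hP : 0 ≤ α + (1 - α) * (3 / 8) := by positivity
  have h5 := mul_le_mul_of_nonneg_left h4 hP
  -- The required inequality after inserting the bounds and dividing by `1 - α`.
  have poly : 0 ≤ 3 / 8 * ((3 + 5 * α) / 8) - (1 + 15 * α) / 128 - (1 - α) / 8 -
      (3 + 5 * α) / 8 * (50 / 256) * (1 - α) * (5 + 27 * α) ^ 2 / 256 := by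
    nlinarith only [h0, he, mul_nonneg h0 he, mul_nonneg h0 (mul_nonneg he he),
      mul_nonneg h0 (sq_nonneg (α - 1 / 2)), mul_nonneg (mul_nonneg h0 he) (sq_nonneg (α - 1 / 2)),
      mul_nonneg h0 (sq_nonneg (α - 2 / 3))]
  have poly' := mul_nonneg he poly
  nlinarith only [poly', h5, hq]

lemma mul_succ_le_two_pow (hN : 5 ≤ N) : 16 * (N + 1) ≤ 3 * 2 ^ N := by
  induction N, hN using Nat.le_induction with
  | base => norm_num
  | succ n hn ih => rw [pow_succ]; omega

lemma mul_succ_sq_le_two_pow (hN : 5 ≤ N) : 8 * (N + 1) ^ 2 ≤ 9 * 2 ^ N := by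
  induction N, hN using Nat.le_induction with
  | base => norm_num
  | succ n hn ih =>
    rw [pow_succ 2]
    nlinarith

lemma splits_many_levels (hN : 5 ≤ N) (hα : α ∈ Set.Icc (0 : ℝ) 1) :
    Splits N α (uN N 0 α + uN N 1 α) := by
  obtain ⟨lam, hlam⟩ : ∃ lam, lam = uN N 0 α + uN N 1 α := ⟨_, rfl⟩
  have hmem := uN_add_uN_mem (N := N) (by omega) hα
  have hsq := uN_add_uN_sq_le (N := N) hα
  rw [← hlam] at hmem hsq
  rw [← hlam]
  have hu := uN_sq hα N 0
  have h0 := hα.1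
  have he := sub_nonneg.2 hα.2
  have hl0 := hmem.1
  have hN' : (5 : ℝ) ≤ N := by exact_mod_cast hN
  have c0 : coin N 0 = 1 / 2 ^ N := by simp [coin]
  have c1 : coin N 1 = N / 2 ^ N := by simp [coin]
  have c2 : coin N 2 = (N * (N - 1) / 2) / 2 ^ N := by
    rw [coin, Nat.cast_choose_two]
  have hp : (0 : ℝ) < 2 ^ N := by positivity
  -- `3 / 16` here and `9 / 8` below are the values at `N = 5`, the worst case.
  have hs1 : ((N : ℝ) + 1) / 2 ^ N ≤ 3 / 16 := by
    rw [div_le_div_iff₀ hp (by norm_num)]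
    have : (16 : ℝ) * (N + 1) ≤ 3 * 2 ^ N := by exact_mod_cast mul_succ_le_two_pow hN
    linarith
  have hs2 : ((N : ℝ) + 1) * (((N : ℝ) + 1) / 2 ^ N) ≤ 9 / 8 := by
    rw [← mul_div_assoc, div_le_div_iff₀ hp (by norm_num)]
    have : (8 : ℝ) * (N + 1) ^ 2 ≤ 9 * 2 ^ N := by exact_mod_cast mul_succ_sq_le_two_pow hN
    linarith
  have hc01 : coin N 0 + coin N 1 = ((N : ℝ) + 1) / 2 ^ N := by rw [c0, c1]; ring
  rw [hc01] at hsq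
  have hs0 : 0 ≤ ((N : ℝ) + 1) / 2 ^ N := by positivity
  have hlen : ∀ b : ℝ, 0 ≤ b → lam ^ 2 * b ≤ (b * (((N : ℝ) + 1) / 2 ^ N)) *
      ((1 - α) * (2 * α + 3 / 16 * (1 - α))) := fun b hb => by
    calc lam ^ 2 * b ≤ (((N : ℝ) + 1) / 2 ^ N * (1 - α) *
          (2 * α + ((N : ℝ) + 1) / 2 ^ N * (1 - α))) * b := by gcongr
      _ ≤ (((N : ℝ) + 1) / 2 ^ N * (1 - α) * (2 * α + 3 / 16 * (1 - α))) * b := by gcongr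
      _ = _ := by ring
  have hmax : (1 - α) * (2 * α + 3 / 16 * (1 - α)) ≤ 16 / 29 := by
    nlinarith only [sq_nonneg (29 * (1 - α) - 16)]
  have hmax0 : 0 ≤ (1 - α) * (2 * α + 3 / 16 * (1 - α)) := by positivity
  have hl9 : lam ^ 2 ≤ 1 / 9 := by
    have := hlen 1 zero_le_one
    rw [mul_one, one_mul] at this
    calc lam ^ 2 ≤ 3 / 16 * (16 / 29) := this.trans (by gcongr)
      _ ≤ 1 / 9 := by norm_num
  have hlN : lam ^ 2 * (N + 1) ≤ 1 := by
    calc lam ^ 2 * (N + 1) ≤ 9 / 8 * (16 / 29) :=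
          (hlen ((N : ℝ) + 1) (by positivity)).trans (by gcongr)
      _ ≤ 1 := by norm_num
  have hl4 : lam ^ 4 ≤ (1 / 9) ^ 2 := by
    calc lam ^ 4 = (lam ^ 2) ^ 2 := by ring
      _ ≤ _ := by gcongr
  have hl6 : lam ^ 6 ≤ (1 / 9) ^ 3 := by
    calc lam ^ 6 = (lam ^ 2) ^ 3 := by ring
      _ ≤ _ := by gcongr
  have hfar1 : (N + 1) * lam ^ 8 ≤ (1 / 9) ^ 2 * lam ^ 2 := by
    calc (N + 1) * lam ^ 8 = (lam ^ 2 * (N + 1)) * lam ^ 4 * lam ^ 2 := by ring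
      _ ≤ 1 * (1 / 9) ^ 2 * lam ^ 2 := by gcongr
      _ = _ := by ring
  have hfar2 : lam ^ 8 ≤ (1 / 9) ^ 3 * lam ^ 2 := by
    calc lam ^ 8 = lam ^ 6 * lam ^ 2 := by ring
      _ ≤ _ := by gcongr
  have hr : lam ^ ((N - 2) ^ 2) ≤ lam ^ 8 := by
    refine pow_le_pow_of_le_one hl0 hmem.2 ?_
    have : 3 ^ 2 ≤ (N - 2) ^ 2 := Nat.pow_le_pow_left (by omega) 2
    omega
  obtain ⟨η, hη⟩ : ∃ η, η = (1 - α) / 2 ^ N := ⟨_, rfl⟩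
  have hη0 : 0 ≤ η := by rw [hη]; positivity
  obtain ⟨K, hK⟩ : ∃ K : ℝ, K = N * (N - 1) / 2 := ⟨_, rfl⟩
  have hK2 : 2 * (N : ℝ) ≤ K := by rw [hK]; nlinarith only [hN']
  have e0 : coin N 0 * (1 - α) = η := by rw [c0, hη]; ring
  have e1 : (1 - α) * coin N 1 = N * η := by rw [c1, hη]; ring
  have e2 : (1 - α) * coin N 2 = K * η := by rw [c2, hη, hK]; ring
  have hsq' : lam ^ 2 ≤ (N + 1) * η * (2 * α + (N + 1) * η) := by
    refine hsq.trans_eq ?_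
    rw [hη]; ring
  rw [e0] at hu
  -- The terms in `lam ^ 8` cost at most `(1 / 81 + 2 / 729) * lam ^ 2 ≤ lam ^ 2 / 64`; together
  -- with `lam ^ 2 / 2` this is `33 / 64 * lam ^ 2`. Expanding through `hsq'` leaves these
  -- conditions on the coefficients of `η * α` and `η ^ 2`.
  have hKlin : 33 / 32 * ((N : ℝ) + 1) + 2 ≤ K := by rw [hK]; nlinarith only [hN']
  have hKsq : 33 / 64 * ((N : ℝ) + 1) ^ 2 + 2 + 2 * N ^ 2 ≤ K ^ 2 := by
    have : (2 * (N : ℝ)) ^ 2 ≤ K ^ 2 := by gcongr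
    nlinarith only [this, hN']
  have hKη : 0 ≤ K * η := mul_nonneg (by linarith) hη0
  have hP1 : α + K * η ≤ 1 := by
    rw [← e2]
    nlinarith only [coin_le_one N 2, he]
  have main : (N + 1) * lam ^ 8 + lam ^ 2 / 2 + 2 * uN N 0 α ^ 2 + 2 * (N * η) ^ 2 +
      (α + K * η) * (2 * lam ^ 8) ≤ (α + K * η) * (K * η) := by
    have h8 : (α + K * η) * (2 * lam ^ 8) ≤ 1 * (2 * lam ^ 8) := by gcongr
    have hlin := mul_le_mul_of_nonneg_right hKlin (mul_nonneg hη0 h0)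
    have hquad := mul_le_mul_of_nonneg_right hKsq (mul_nonneg hη0 hη0)
    rw [hu]
    nlinarith only [h8, hfar1, hfar2, hsq', hlin, hquad, sq_nonneg lam]
  refine splits_of_residual_le (by omega) hα hlam fun j hj => ?_
  have hT := sum_share_mul_residual_sq_le (by omega) hα hlam hj
  rw [e1] at hT
  have hj' : 2 ≤ (j : ℕ) ∧ (j : ℕ) + 2 ≤ N := by
    simp only [IsOuter] at hj
    omega
  have hcj : K * η ≤ (1 - α) * coin N j := by
    rw [← e2]
    exact mul_le_mul_of_nonneg_left (coin_two_le_coin hj'.1 hj'.2) he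
  set q := (1 - α) * coin N j
  -- Among inner outcomes `j = 2` is the worst: its binomial weight is smallest, and the available
  -- room grows with `q`.
  have hmono : (α + K * η) * (K * η - 2 * lam ^ 8) ≤ (α + q) * (q - 2 * lam ^ ((N - 2) ^ 2)) := by
    have hlt : K * η - 2 * lam ^ 8 ≤ q - 2 * lam ^ ((N - 2) ^ 2) := by linarith
    have hnn : 0 ≤ (α + K * η) * (K * η - 2 * lam ^ 8) := by
      have : 0 ≤ (N + 1) * lam ^ 8 + lam ^ 2 / 2 + 2 * uN N 0 α ^ 2 + 2 * (N * η) ^ 2 := by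
        positivity
      linarith
    rcases (add_nonneg h0 hKη).eq_or_lt with hz | hpos
    · have hα' : α = 0 := by linarith
      have hη' : K * η = 0 := by linarith
      have hη'' : η = 0 := by
        rcases mul_eq_zero.1 hη' with h | h
        · linarith
        · exact h
      rw [hη, hα', div_eq_zero_iff] at hη''
      norm_num at hη''
    · have : 0 ≤ K * η - 2 * lam ^ 8 := nonneg_of_mul_nonneg_right hnn hpos
      have : 0 ≤ α + q := by linarith
      gcongr
  linarith

end ManyLevelsBounds

/-! ### Asymptotics -/

section Asymptotics

variable {N : ℕ} {α : ℝ}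

lemma splits_uN_add_uN (hN : 1 ≤ N) (hN2 : N ≠ 2) (hα : α ∈ Set.Icc (0 : ℝ) 1) :
    Splits N α (uN N 0 α + uN N 1 α) := by
  rcases (by omega : N = 1 ∨ N = 3 ∨ N = 4 ∨ 5 ≤ N) with rfl | rfl | rfl | h
  · exact splits_one_level hα
  · exact splits_three_levels hα
  · exact splits_four_levels hα
  · exact splits_many_levels h hα

lemma kN_eq (N : ℕ) : kN N = √(coin N 0) + √(coin N 1) := by
  have h : (2 : ℝ) ^ ((N : ℝ) / 2) = √(2 ^ N) := by
    rw [Real.sqrt_eq_rpow, ← Real.rpow_natCast, ← Real.rpow_mul (by norm_num)]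
    ring_nf
  rw [kN, h, coin, coin, Real.sqrt_div' _ (by positivity), Real.sqrt_div' _ (by positivity)]
  simp [add_div]

lemma kN_nonneg (N : ℕ) : 0 ≤ kN N := by
  rw [kN_eq]; positivity

lemma uN_add_uN_le (hα : α ∈ Set.Icc (0 : ℝ) 1) :
    uN N 0 α + uN N 1 α ≤ kN N * √(1 - α) := by
  have h : ∀ k, uN N k α ≤ √(coin N k) * √(1 - α) := fun k => by
    rw [uN_eq_mul hα, Real.sqrt_mul (coin_nonneg N k)]
    refine mul_le_of_le_one_right (by positivity) (Real.sqrt_le_one.2 ?_)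
    nlinarith [coin_le_one N k, hα.2]
  rw [kN_eq, add_mul]
  exact add_le_add (h 0) (h 1)

lemma sqrt_mul_sqrt_le_uN (hα : α ∈ Set.Icc (0 : ℝ) 1) (k : ℕ) :
    √(coin N k) * √(1 - α) * √α ≤ uN N k α := by
  rw [uN_eq_mul hα, Real.sqrt_mul (coin_nonneg N k)]
  have := mul_nonneg (coin_nonneg N k) (sub_nonneg.2 hα.2)
  gcongr
  linarith

/-- Dropping `c k * (1 - α)` under the second root leaves a factor `√α ≥ α = 1 - (1 - α)`. -/
lemma le_uN_add_uN (hα : α ∈ Set.Icc (0 : ℝ) 1) :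
    kN N * √(1 - α) - kN N * ((1 - α) * √(1 - α)) ≤ uN N 0 α + uN N 1 α := by
  have h0 := sqrt_mul_sqrt_le_uN (N := N) hα 0
  have h1 := sqrt_mul_sqrt_le_uN (N := N) hα 1
  have h2 : α ≤ √α := Real.le_sqrt_of_sq_le (by nlinarith [hα.1, hα.2])
  have h3 : kN N * √(1 - α) * α ≤ kN N * √(1 - α) * √α :=
    mul_le_mul_of_nonneg_left h2 (mul_nonneg (kN_nonneg N) (Real.sqrt_nonneg _))
  have h4 : kN N * √(1 - α) * √α =
      √(coin N 0) * √(1 - α) * √α + √(coin N 1) * √(1 - α) * √α := by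
    rw [kN_eq]; ring
  linarith

lemma beta_le_kN (hα : α ∈ Set.Icc (0 : ℝ) 1) :
    beta N 0 1 α ≤ kN N * √(1 - α) + (1 - α) := by
  have h1 := uN_add_uN_le (N := N) hα
  have h2 : (1 - α) * (1 - coin N 0 - coin N 1) ≤ 1 - α :=
    mul_le_of_le_one_right (sub_nonneg.2 hα.2)
      (by linarith [coin_nonneg N 0, coin_nonneg N 1])
  rw [beta_eq]
  linarith

lemma div_rpow_three_halves (h0 : 0 < α) (h1 : α ≤ 1) :
    ((1 - α) / α) ^ (3 / 2 : ℝ) = (1 - α) * √(1 - α) / (α * √α) := by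
  have h : 0 ≤ (1 - α) / α := div_nonneg (sub_nonneg.2 h1) h0.le
  rw [show (3 / 2 : ℝ) = 1 + 1 / 2 by norm_num, Real.rpow_add_of_nonneg h (by norm_num)
    (by norm_num), Real.rpow_one, ← Real.sqrt_eq_rpow, Real.sqrt_div (sub_nonneg.2 h1),
    div_mul_div_comm]

lemma abs_unitInv_alphaN_sub_le (hN : 1 ≤ N) (h0 : 0 < α) (h1 : α ≤ 1) :
    |unitInv (alphaN N) α - kN N * √(1 - α)| ≤
      1 - α + 3 / 2 * kN N * ((1 - α) / α) ^ (3 / 2 : ℝ) := by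
  have hα : α ∈ Set.Icc (0 : ℝ) 1 := ⟨h0.le, h1⟩
  have he := sub_nonneg.2 h1
  have hk := kN_nonneg N
  rw [div_rpow_three_halves h0 h1]
  have hs : 0 < √α := Real.sqrt_pos.2 h0
  have hs1 : √α ≤ 1 := Real.sqrt_le_one.2 h1
  set z := (1 - α) * √(1 - α) / (α * √α) with hz
  have hw : 0 ≤ (1 - α) * √(1 - α) := by positivity
  have hz0 : 0 ≤ z := by positivity
  have hz1 : (1 - α) * √(1 - α) / √α ≤ z := by
    rw [hz]
    gcongr
    exact mul_le_of_le_one_left hs.le h1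
  have hz2 : (1 - α) * √(1 - α) ≤ z := (le_div_self hw hs hs1).trans hz1
  have hkz : kN N * ((1 - α) * √(1 - α)) ≤ kN N * z := by gcongr
  have hkz0 : 0 ≤ kN N * z := by positivity
  have hlow := le_uN_add_uN (N := N) hα
  rw [abs_le]
  constructor
  · by_cases hN2 : N = 2
    · subst hN2
      rcases h1.eq_or_lt with h1' | h1'
      · have := unitInv_mem (bijOn_alphaN (N := 2) hN) hα
        subst h1'
        simp only [sub_self, Real.sqrt_zero, mul_zero, sub_zero, zero_add]
        have := this.1
        linarith
      · obtain ⟨hsp, hm⟩ := splits_two_levels h0 h1'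
        have hle := hsp.le_unitInv hN hα hm
        have hk1 : 1 ≤ kN 2 := by
          obtain ⟨c0, c1, -⟩ := coin_two
          rw [kN_eq, c0, c1]
          have e1 : (1 / 2 : ℝ) ≤ √(1 / 4) := Real.le_sqrt_of_sq_le (by norm_num)
          have e2 : (1 / 2 : ℝ) ≤ √(1 / 2) := Real.le_sqrt_of_sq_le (by norm_num)
          linarith
        have hu : 1 / 2 * √(1 - α) * √α ≤ uN 2 0 α := by
          obtain ⟨c0, -, -⟩ := coin_two
          have e1 : (1 / 2 : ℝ) ≤ √(1 / 4) := Real.le_sqrt_of_sq_le (by norm_num)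
          have := sqrt_mul_sqrt_le_uN (N := 2) hα 0
          rw [c0] at this
          refine le_trans ?_ this
          gcongr
        have he' : 0 < √(1 - α) := Real.sqrt_pos.2 (sub_pos.2 h1')
        -- The two-qubit correction is of order `(1 - α) ^ (3 / 2)`, and `1 ≤ kN 2` makes it fit in
        -- the allowance of `kN 2 * z / 2`.
        have hcorr : (1 - α) ^ 2 / (16 * uN 2 0 α) ≤ z / 8 := by
          calc (1 - α) ^ 2 / (16 * uN 2 0 α)
              ≤ (1 - α) ^ 2 / (16 * (1 / 2 * √(1 - α) * √α)) := by gcongr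
            _ = ((1 - α) * √(1 - α) / √α) / 8 := by
                rw [div_div, div_eq_div_iff (by positivity) (by positivity)]
                linear_combination (-(8 * (1 - α) * √α)) * Real.mul_self_sqrt he
            _ ≤ z / 8 := by gcongr
        have hzk : z ≤ kN 2 * z := le_mul_of_one_le_left hz0 hk1
        linarith
    · have := (splits_uN_add_uN hN hN2 hα).le_unitInv hN hα (uN_add_uN_mem hN hα)
      linarith
  · have := (splits_unitInv hN hα).le_beta hN hα
    have := beta_le_kN (N := N) hα
    linarith

lemma isBigO_of_abs_le {f : ℝ → ℝ} {c : ℝ}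
    (h : ∀ α : ℝ, 1 / 2 ≤ α → α ≤ 1 → |f α| ≤ c * (1 - α)) :
    f =O[𝓝[≤] 1] fun α : ℝ => 1 - α := by
  refine Asymptotics.IsBigO.of_bound c ?_
  filter_upwards [Icc_mem_nhdsLE (by norm_num : (1 / 2 : ℝ) < 1)] with α hα
  rw [Real.norm_eq_abs, Real.norm_eq_abs, abs_of_nonneg (sub_nonneg.2 hα.2)]
  exact h α hα.1 hα.2

lemma isBigO_unitInv_alphaN (hN : 1 ≤ N) :
    (fun α : ℝ => unitInv (alphaN N) α - kN N * √(1 - α)) =O[𝓝[≤] 1] fun α : ℝ => 1 - α := by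
  -- For `α ≥ 1 / 2` the power `3 / 2` is at most `4 * (1 - α)`, and `3 / 2 * 4 = 6`.
  refine isBigO_of_abs_le (c := 1 + 6 * kN N) fun α h0 h1 => ?_
  have hpos : 0 < α := by linarith
  have he := sub_nonneg.2 h1
  have hk := kN_nonneg N
  refine (abs_unitInv_alphaN_sub_le hN hpos h1).trans ?_
  have hs : 1 / 2 ≤ √α := Real.le_sqrt_of_sq_le (by linarith)
  have hs1 : √(1 - α) ≤ 1 := Real.sqrt_le_one.2 (by linarith)
  have : ((1 - α) / α) ^ (3 / 2 : ℝ) ≤ 4 * (1 - α) := by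
    rw [div_rpow_three_halves hpos h1]
    calc (1 - α) * √(1 - α) / (α * √α) ≤ (1 - α) * 1 / (1 / 2 * (1 / 2)) := by gcongr
      _ = 4 * (1 - α) := by ring
  have := mul_le_mul_of_nonneg_left this (by positivity : 0 ≤ 3 / 2 * kN N)
  linarith

lemma isBigO_unitInv_upperN (hN : 1 ≤ N) :
    (fun α : ℝ => unitInv (upperN N) α - kN N * √(1 - α)) =O[𝓝[≤] 1] fun α : ℝ => 1 - α := by
  refine isBigO_of_abs_le (c := 1 + kN N) fun α h0 h1 => ?_
  have hα : α ∈ Set.Icc (0 : ℝ) 1 := ⟨by linarith, h1⟩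
  have he := sub_nonneg.2 h1
  have hk := kN_nonneg N
  have hs1 : √(1 - α) ≤ 1 := Real.sqrt_le_one.2 (by linarith)
  rw [upperN, unitInv_unitInv (bijOn_beta hN) hα]
  have hup := beta_le_kN (N := N) hα
  have hlow := le_uN_add_uN (N := N) hα
  have hc := mul_nonneg he (by linarith [coin_zero_add_coin_one_le hN] :
    0 ≤ 1 - coin N 0 - coin N 1)
  have hke : kN N * ((1 - α) * √(1 - α)) ≤ kN N * (1 - α) := by
    gcongr
    exact mul_le_of_le_one_right he hs1
  have hke0 : 0 ≤ kN N * (1 - α) := by positivity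
  rw [abs_le]
  constructor
  · rw [beta_eq]
    linarith
  · linarith

end Asymptotics

end CoherenceIncompat

open CoherenceIncompat in
theorem proposition5 (N : ℕ) (hN : 1 ≤ N) :
    -- the maximum defining `α_N` exists, and the inverse functions below make sense
    (∀ lam ∈ Set.Icc (0 : ℝ) 1, IsGreatest (compatWeights N lam) (alphaN N lam)) ∧
    StrictAntiOn (alphaN N) (Set.Icc 0 1) ∧
    Set.BijOn (alphaN N) (Set.Icc 0 1) (Set.Icc 0 1) ∧
    StrictAntiOn (beta N 0 1) (Set.Icc 0 1) ∧
    Set.BijOn (beta N 0 1) (Set.Icc 0 1) (Set.Icc 0 1) ∧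
    Set.BijOn (upperN N) (Set.Icc 0 1) (Set.Icc 0 1) ∧
    -- common asymptotic form of both curves as `α → 1`
    ((fun α : ℝ => unitInv (alphaN N) α - kN N * √(1 - α)) =O[𝓝[≤] 1] fun α : ℝ => 1 - α) ∧
    ((fun α : ℝ => unitInv (upperN N) α - kN N * √(1 - α)) =O[𝓝[≤] 1] fun α : ℝ => 1 - α) ∧
    -- explicit error bound
    (∀ α : ℝ, 0 < α → α ≤ 1 →
      |unitInv (alphaN N) α - kN N * √(1 - α)|
        ≤ 1 - α + 3 / 2 * kN N * ((1 - α) / α) ^ (3 / 2 : ℝ)) ∧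
    -- lower bound for the true curve, and the incoherent instruments realising it
    (N ≠ 2 → ∀ α ∈ Set.Icc (0 : ℝ) 1,
      uN N 0 α + uN N 1 α ≤ unitInv (alphaN N) α ∧
      ∃ I : Fin (N + 1) → (Matrix (Fin N → Fin 2) (Fin N → Fin 2) ℂ →ₗ[ℂ]
          Matrix (Fin N → Fin 2) (Fin N → Fin 2) ℂ),
        IsGII I ∧ HasCoherenceMatrix I (spinBoson N (uN N 0 α + uN N 1 α)) ∧
          Measures I (dfsMix N α)) := by
  refine ⟨fun lam hl => isGreatest_alphaN hl, strictAntiOn_alphaN hN, bijOn_alphaN hN,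
    strictAntiOn_beta hN, bijOn_beta hN, bijOn_unitInv (bijOn_beta hN), isBigO_unitInv_alphaN hN,
    isBigO_unitInv_upperN hN, fun α h0 h1 => abs_unitInv_alphaN_sub_le hN h0 h1,
    fun hN2 α hα => ?_⟩
  have h := splits_uN_add_uN hN hN2 hα
  exact ⟨h.le_unitInv hN hα (uN_add_uN_mem hN hα), h.exists_instrument⟩
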